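/- Let $X_1, X_2, \ldots$ be independent, identically distributed real random variables with mean zero and variance $\sigma^2$, and suppose that $\mathbb{E}\left[|X_1|^{2+\delta}\right] < \infty$ for some $\delta > 0$. For a positive integer $N$ let $\mathcal{P}_N$ denote the set of all partitions of $[N] = \{1, \ldots, N\}$ into intervals of consecutive integers. Then, almost surely, $$\max_{\pi \in \mathcal{P}_N} \sum_{I \in \pi} \Big| \sum_{i \in I} X_i \Big|^2 \sim 2\sigma^2 N \ln\ln N \qquad (N \to \infty).$$ Here $a_N \sim b_N$ means $a_N - b_N = o(b_N)$, that is, $a_N / b_N \to 1$ if $\sigma \neq 0$, and in the degenerate case $\sigma = 0$ that both sides are $0$ for all large $N$. -/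

import Mathlib

open MeasureTheory ProbabilityTheory Filter Asymptotics

/-- The first `N` indices, here labelled `0, …, N - 1`, are partitioned into (nonempty) blocks.
The partition `π` is a partition into intervals if each block is an interval of consecutive
integers. -/
def IsIntervalPartition {N : ℕ} (π : Finpartition (Finset.range N)) : Prop :=
  ∀ I ∈ π.parts, ∃ a b : ℕ, I = Finset.Ico a b

open scoped Classical in
/-- The finite set of all partitions of the first `N` indices into intervals. -/
noncomputable def intervalPartitions (N : ℕ) : Finset (Finpartition (Finset.range N)) :=
  {π | IsIntervalPartition π}

/-- The partition into singletons is a partition into intervals. -/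
theorem intervalPartitions_nonempty (N : ℕ) : (intervalPartitions N).Nonempty := by
  refine ⟨⊥, ?_⟩
  simp only [intervalPartitions, Finset.mem_filter, Finset.mem_univ, true_and]
  intro I hI
  obtain ⟨a, -, rfl⟩ := Finpartition.mem_bot_iff.mp hI
  exact ⟨a, a + 1, (Nat.Ico_succ_singleton a).symm⟩

/-- The square variation of the first `N` terms of the real sequence `x`: the maximum over all
partitions `π` of the first `N` indices into intervals of `∑_{I ∈ π} |∑_{i ∈ I} x i| ^ 2`. -/
noncomputable def squareVariation (x : ℕ → ℝ) (N : ℕ) : ℝ :=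
  (intervalPartitions N).sup' (intervalPartitions_nonempty N)
    fun π => ∑ I ∈ π.parts, |∑ i ∈ I, x i| ^ 2

/-- A finite family of pairwise disjoint nonempty intervals of integers contained in `[a, b)`. -/
def IsPacking (a b : ℕ) (F : Finset (Finset ℕ)) : Prop :=
  (∀ I ∈ F, ∃ c d, a ≤ c ∧ c < d ∧ d ≤ b ∧ I = Finset.Ico c d) ∧
    (F : Set (Finset ℕ)).PairwiseDisjoint id

theorem isPacking_empty (a b : ℕ) : IsPacking a b ∅ := by
  simp [IsPacking]

theorem isPacking_singleton {a b c d : ℕ} (hac : a ≤ c) (hcd : c < d) (hdb : d ≤ b) :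
    IsPacking a b {Finset.Ico c d} := by
  refine ⟨fun I hI => ⟨c, d, hac, hcd, hdb, by simpa using hI⟩, by simp⟩

theorem IsPacking.mono {a b a' b' : ℕ} {F : Finset (Finset ℕ)} (h : IsPacking a b F)
    (ha : a' ≤ a) (hb : b ≤ b') : IsPacking a' b' F := by
  refine ⟨fun I hI => ?_, h.2⟩
  obtain ⟨c, d, h1, h2, h3, h4⟩ := h.1 I hI
  exact ⟨c, d, ha.trans h1, h2, h3.trans hb, h4⟩

theorem IsPacking.exists_union {a b c : ℕ} {F G : Finset (Finset ℕ)} (hF : IsPacking a b F)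
    (hG : IsPacking b c G) (hab : a ≤ b) (hbc : b ≤ c) :
    IsPacking a c (F ∪ G) ∧ Disjoint F G := by
  have key : ∀ I ∈ F, ∀ J ∈ G, Disjoint I J := by
    intro I hI J hJ
    obtain ⟨p, q, -, -, h3, rfl⟩ := hF.1 I hI
    obtain ⟨p', q', h1, -, -, rfl⟩ := hG.1 J hJ
    exact Finset.disjoint_left.2 fun x hx hx' => by
      simp only [Finset.mem_Ico] at hx hx'
      omega
  refine ⟨⟨fun I hI => ?_, ?_⟩, ?_⟩
  · rcases Finset.mem_union.1 hI with h | h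
    · exact (hF.mono le_rfl hbc).1 I h
    · exact (hG.mono hab le_rfl).1 I h
  · intro I hI J hJ hIJ
    rcases Finset.mem_union.1 (Finset.mem_coe.1 hI) with h | h <;>
      rcases Finset.mem_union.1 (Finset.mem_coe.1 hJ) with h' | h'
    · exact hF.2 h h' hIJ
    · exact key I h J h'
    · exact (key J h' I h).symm
    · exact hG.2 h h' hIJ
  · refine Finset.disjoint_left.2 fun I hI hI' => ?_
    have h1 := key I hI I hI'
    obtain ⟨p, q, -, h2, -, rfl⟩ := hF.1 I hI
    rw [disjoint_self] at h1
    simp only [Finset.bot_eq_empty, Finset.Ico_eq_empty_iff] at h1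
    exact h1 h2

theorem isPacking_parts {N : ℕ} {π : Finpartition (Finset.range N)} (hπ : IsIntervalPartition π) :
    IsPacking 0 N π.parts := by
  refine ⟨fun I hI => ?_, π.disjoint⟩
  obtain ⟨a, b, rfl⟩ := hπ I hI
  have hne := π.nonempty_of_mem_parts hI
  have hab : a < b := Finset.nonempty_Ico.1 hne
  refine ⟨a, b, Nat.zero_le _, hab, ?_, rfl⟩
  have := π.le hI (Finset.mem_Ico.2 ⟨Nat.le_sub_one_of_lt hab, by omega⟩)
  simp only [Finset.mem_range] at this
  omega

theorem squareVariation_le {x : ℕ → ℝ} {N : ℕ} {B : ℝ}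
    (h : ∀ F, IsPacking 0 N F → ∑ I ∈ F, |∑ i ∈ I, x i| ^ 2 ≤ B) : squareVariation x N ≤ B := by
  refine Finset.sup'_le _ _ fun π hπ => h _ (isPacking_parts ?_)
  simpa [intervalPartitions] using hπ

theorem IsPacking.exists_intervalPartition {N : ℕ} {F : Finset (Finset ℕ)}
    (hF : IsPacking 0 N F) : ∃ π ∈ intervalPartitions N, F ⊆ π.parts := by
  classical
  set U : Finset ℕ := F.sup id with hU
  have hUN : U ⊆ Finset.range N := by
    refine Finset.sup_le fun I hI => ?_
    obtain ⟨p, q, -, -, h3, rfl⟩ := hF.1 I hI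
    intro x hx
    simp only [id, Finset.mem_Ico, Finset.mem_range] at hx ⊢
    omega
  have hsub : ∀ I ∈ F, I ⊆ U := fun I hI => Finset.le_sup (f := id) hI
  set G : Finset (Finset ℕ) := (Finset.range N \ U).image fun n => {n} with hG
  have hGm : ∀ I ∈ G, ∃ n, n < N ∧ n ∉ U ∧ I = {n} := by
    intro I hI
    obtain ⟨n, hn, rfl⟩ := Finset.mem_image.1 hI
    simp only [Finset.mem_sdiff, Finset.mem_range] at hn
    exact ⟨n, hn.1, hn.2, rfl⟩
  have hdisj : ((F ∪ G : Finset (Finset ℕ)) : Set (Finset ℕ)).PairwiseDisjoint id := by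
    have key : ∀ I ∈ F, ∀ J ∈ G, Disjoint I J := by
      intro I hI J hJ
      obtain ⟨n, -, hn, rfl⟩ := hGm J hJ
      exact Finset.disjoint_singleton_right.2 fun h => hn (hsub I hI h)
    intro I hI J hJ hIJ
    rcases Finset.mem_union.1 (Finset.mem_coe.1 hI) with h | h <;>
      rcases Finset.mem_union.1 (Finset.mem_coe.1 hJ) with h' | h'
    · exact hF.2 h h' hIJ
    · exact key I h J h'
    · exact (key J h' I h).symm
    · obtain ⟨n, -, -, rfl⟩ := hGm I h
      obtain ⟨m, -, -, rfl⟩ := hGm J h'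
      simp only [Function.onFun, id, Finset.disjoint_singleton]
      exact fun e => hIJ (by rw [e])
  let π : Finpartition (Finset.range N) :=
    { parts := F ∪ G
      supIndep := Finset.supIndep_iff_pairwiseDisjoint.2 hdisj
      sup_parts := by
        apply le_antisymm
        · refine Finset.sup_le fun I hI => ?_
          rcases Finset.mem_union.1 hI with h | h
          · exact (hsub I h).trans hUN
          · obtain ⟨n, hn, -, rfl⟩ := hGm I h
            simpa using hn
        · intro n hn
          by_cases h : n ∈ U
          · rw [Finset.sup_union]
            exact Finset.mem_union_left _ h
          · have : ({n} : Finset ℕ) ≤ (F ∪ G).sup id :=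
              Finset.le_sup (f := id) (Finset.mem_union_right _ (Finset.mem_image.2
                ⟨n, Finset.mem_sdiff.2 ⟨hn, h⟩, rfl⟩))
            exact this (Finset.mem_singleton_self n)
      bot_notMem := by
        intro h
        rcases Finset.mem_union.1 h with h | h
        · obtain ⟨p, q, -, h2, -, h4⟩ := hF.1 _ h
          have : p ∈ (⊥ : Finset ℕ) := by rw [h4]; simp [h2]
          simp at this
        · obtain ⟨n, -, -, h⟩ := hGm _ h
          exact Finset.singleton_ne_empty n h.symm }
  refine ⟨π, ?_, Finset.subset_union_left⟩
  simp only [intervalPartitions, Finset.mem_filter, Finset.mem_univ, true_and]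
  intro I hI
  rcases Finset.mem_union.1 hI with h | h
  · obtain ⟨p, q, -, -, -, h4⟩ := hF.1 _ h
    exact ⟨p, q, h4⟩
  · obtain ⟨n, -, -, rfl⟩ := hGm _ h
    exact ⟨n, n + 1, (Nat.Ico_succ_singleton n).symm⟩

theorem IsPacking.le_squareVariation {x : ℕ → ℝ} {N : ℕ} {F : Finset (Finset ℕ)}
    (hF : IsPacking 0 N F) : ∑ I ∈ F, |∑ i ∈ I, x i| ^ 2 ≤ squareVariation x N := by
  obtain ⟨π, hπ, hsub⟩ := hF.exists_intervalPartition
  refine le_trans (Finset.sum_le_sum_of_subset_of_nonneg hsub fun _ _ _ => by positivity) ?_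
  exact Finset.le_sup' (fun π : Finpartition (Finset.range N) =>
    ∑ I ∈ π.parts, |∑ i ∈ I, x i| ^ 2) hπ

theorem IsPacking.sum_card_le {a b : ℕ} {F : Finset (Finset ℕ)} (hF : IsPacking a b F) :
    ∑ I ∈ F, I.card ≤ b - a := by
  classical
  have h : (F.biUnion id).card = ∑ I ∈ F, I.card := Finset.card_biUnion hF.2
  rw [← h, ← Nat.card_Ico]
  refine Finset.card_le_card (Finset.biUnion_subset.2 fun I hI => ?_)
  obtain ⟨c, d, h1, -, h3, rfl⟩ := hF.1 I hI
  exact Finset.Ico_subset_Ico h1 h3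

/-- Greedy covering: if every point of `G` starts a window carrying a packing whose weight is at
least `A` times the length of the window, then `[0, N)` carries a packing of weight at least
`A * #G`. -/
theorem exists_isPacking_card_mul_le {N : ℕ} {A : ℝ} (hA : 0 ≤ A) (w : Finset ℕ → ℝ) (G : Finset ℕ)
    (h : ∀ x ∈ G, ∃ n, 0 < n ∧ x + n ≤ N ∧ ∃ F, IsPacking x (x + n) F ∧ A * n ≤ ∑ I ∈ F, w I) :
    ∃ F, IsPacking 0 N F ∧ A * G.card ≤ ∑ I ∈ F, w I := by
  classical
  have main : ∀ m, ∀ x, x + m = N → ∃ F, IsPacking x N F ∧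
      A * (G.filter (x ≤ ·)).card ≤ ∑ I ∈ F, w I := by
    intro m
    induction m using Nat.strong_induction_on with
    | _ m ih =>
      intro x hx
      by_cases hxG : x ∈ G
      · obtain ⟨n, hn, hxn, F, hF, hFA⟩ := h x hxG
        obtain ⟨F', hF', hFA'⟩ := ih (m - n) (by omega) (x + n) (by omega)
        obtain ⟨hu, hd⟩ := hF.exists_union hF' (by omega) hxn
        refine ⟨F ∪ F', hu, ?_⟩
        rw [Finset.sum_union hd]
        have hc : (G.filter (x ≤ ·)).card ≤ n + (G.filter (x + n ≤ ·)).card := by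
          have : G.filter (x ≤ ·) ⊆ Finset.Ico x (x + n) ∪ G.filter (x + n ≤ ·) := by
            intro y hy
            simp only [Finset.mem_union, Finset.mem_filter, Finset.mem_Ico] at hy ⊢
            by_cases hyx : y < x + n
            · exact Or.inl ⟨hy.2, hyx⟩
            · exact Or.inr ⟨hy.1, by omega⟩
          refine (Finset.card_le_card this).trans ((Finset.card_union_le _ _).trans ?_)
          simp
        have hc' : ((G.filter (x ≤ ·)).card : ℝ) ≤ n + (G.filter (x + n ≤ ·)).card := by
          exact_mod_cast hc
        nlinarith [mul_le_mul_of_nonneg_left hc' hA]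
      · rcases Nat.eq_zero_or_pos m with rfl | hm
        · refine ⟨∅, isPacking_empty _ _, ?_⟩
          have : G.filter (x ≤ ·) = ∅ := by
            refine Finset.filter_eq_empty_iff.2 fun y hy hxy => ?_
            obtain ⟨n, hn, hyn, -⟩ := h y hy
            omega
          simp [this]
        · obtain ⟨F, hF, hFA⟩ := ih (m - 1) (by omega) (x + 1) (by omega)
          refine ⟨F, hF.mono (by omega) le_rfl, ?_⟩
          have : G.filter (x ≤ ·) = G.filter (x + 1 ≤ ·) := by
            refine Finset.filter_congr fun y hy => ?_
            have : x ≠ y := fun e => hxG (e ▸ hy)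
            omega
          rwa [this]
  obtain ⟨F, hF, hFA⟩ := main N 0 (by omega)
  exact ⟨F, hF, by simpa using hFA⟩

theorem indepFun_comp_of_dependsOn {Ω : Type*} [MeasurableSpace Ω] {μ : Measure Ω}
    {X : ℕ → Ω → ℝ} (hX : iIndepFun X μ) (hm : ∀ i, Measurable (X i)) {S T : Finset ℕ}
    (hST : Disjoint S T) {β γ : Type*} [MeasurableSpace β] [MeasurableSpace γ]
    {Φ : (ℕ → ℝ) → β} {Ψ : (ℕ → ℝ) → γ} (hΦ : Measurable Φ) (hΨ : Measurable Ψ)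
    (hΦS : DependsOn Φ (S : Set ℕ)) (hΨT : DependsOn Ψ (T : Set ℕ)) :
    IndepFun (fun ω => Φ fun i => X i ω) (fun ω => Ψ fun i => X i ω) μ := by
  classical
  have h := hX.indepFun_finset S T hST hm
  let e : (R : Finset ℕ) → ((i : R) → ℝ) → ℕ → ℝ := fun R y i => if h : i ∈ R then y ⟨i, h⟩ else 0
  have he : ∀ R, Measurable (e R) := by
    intro R
    refine measurable_pi_lambda _ fun i => ?_
    by_cases hi : i ∈ R
    · simpa [e, hi] using measurable_pi_apply _
    · simp [e, hi]
  have h' := h.comp (hΦ.comp (he S)) (hΨ.comp (he T))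
  convert h' using 1
  · funext ω
    refine hΦS fun i hi => ?_
    simp [e, Finset.mem_coe.1 hi]
  · funext ω
    refine hΨT fun i hi => ?_
    simp [e, Finset.mem_coe.1 hi]

theorem identDistrib_precomp {Ω : Type*} [MeasurableSpace Ω] {μ : Measure Ω}
    [IsProbabilityMeasure μ] {X : ℕ → Ω → ℝ} (hX : iIndepFun X μ)
    (hident : ∀ i, IdentDistrib (X i) (X 0) μ μ) {g : ℕ → ℕ} (hg : g.Injective) :
    IdentDistrib (fun ω i => X (g i) ω) (fun ω i => X i ω) μ μ :=
  IdentDistrib.pi (fun i => (hident (g i)).trans (hident i).symm) (hX.precomp hg) hX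

theorem partialSups_sq_div_two_add_le (s : ℕ → ℝ) (n : ℕ) :
    (partialSups s n) ^ 2 / 2 + ∑ i ∈ Finset.range n, partialSups s i * (s (i + 1) - s i) ≤
      partialSups s n * s n := by
  induction n with
  | zero => simp; nlinarith [sq_nonneg (s 0)]
  | succ n ih =>
    rw [Finset.sum_range_succ, partialSups_add_one]
    rcases le_total (s (n + 1)) (partialSups s n) with h | h
    · rw [sup_eq_left.2 h]
      linarith
    · rw [sup_eq_right.2 h]
      nlinarith [sq_nonneg (s (n + 1) - partialSups s n)]

/-- A pathwise form of Doob's `L²` maximal inequality. -/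
theorem partialSups_sq_add_le (s : ℕ → ℝ) (n : ℕ) :
    (partialSups s n) ^ 2 + 4 * ∑ i ∈ Finset.range n, partialSups s i * (s (i + 1) - s i) ≤
      4 * s n ^ 2 := by
  nlinarith [partialSups_sq_div_two_add_le s n, sq_nonneg (2 * s n - partialSups s n)]

theorem integral_partialSups_sq_le {Ω : Type*} [MeasurableSpace Ω] {μ : Measure Ω}
    {f : ℕ → Ω → ℝ} {n : ℕ}
    (h1 : Integrable (fun ω => (partialSups (fun v => f v ω) n) ^ 2) μ)
    (h2 : Integrable (fun ω => f n ω ^ 2) μ)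
    (h3 : ∀ i < n, Integrable (fun ω => partialSups (fun v => f v ω) i * (f (i + 1) ω - f i ω)) μ)
    (h4 : ∀ i < n, 0 ≤ ∫ ω, partialSups (fun v => f v ω) i * (f (i + 1) ω - f i ω) ∂μ) :
    ∫ ω, (partialSups (fun v => f v ω) n) ^ 2 ∂μ ≤ 4 * ∫ ω, f n ω ^ 2 ∂μ := by
  have h3' : Integrable (fun ω => ∑ i ∈ Finset.range n,
      partialSups (fun v => f v ω) i * (f (i + 1) ω - f i ω)) μ :=
    integrable_finsetSum _ fun i hi => h3 i (Finset.mem_range.1 hi)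
  have := integral_mono (h1.add (h3'.const_mul 4)) (h2.const_mul 4)
    fun ω => partialSups_sq_add_le (fun v => f v ω) n
  simp only [Pi.add_apply] at this
  rw [integral_add h1 (h3'.const_mul 4), integral_const_mul, integral_const_mul,
    integral_finsetSum _ fun i hi => h3 i (Finset.mem_range.1 hi)] at this
  have : 0 ≤ ∑ i ∈ Finset.range n,
      ∫ ω, partialSups (fun v => f v ω) i * (f (i + 1) ω - f i ω) ∂μ :=
    Finset.sum_nonneg fun i hi => h4 i (Finset.mem_range.1 hi)
  linarith

theorem measurable_partialSups_comp {α : Type*} [MeasurableSpace α] {f : ℕ → α → ℝ}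
    (hf : ∀ v, Measurable (f v)) (n : ℕ) : Measurable fun y => partialSups (fun v => f v y) n := by
  induction n with
  | zero => simpa using hf 0
  | succ n ih =>
    simp only [partialSups_add_one]
    exact ih.sup (hf (n + 1))

theorem partialSups_congr_of_le {s t : ℕ → ℝ} {n : ℕ} (h : ∀ v ≤ n, s v = t v) :
    partialSups s n = partialSups t n := by
  induction n with
  | zero => simpa using h 0 le_rfl
  | succ n ih =>
    rw [partialSups_add_one, partialSups_add_one, ih fun v hv => h v (by omega), h _ le_rfl]

theorem dependsOn_partialSups (φ : ℝ → ℝ) (n : ℕ) :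
    DependsOn (fun y : ℕ → ℝ => partialSups (fun v => φ (∑ i ∈ Finset.range v, y i)) n)
      ((Finset.range n : Finset ℕ) : Set ℕ) := by
  intro x y hxy
  refine partialSups_congr_of_le fun v hv => ?_
  rw [Finset.sum_congr rfl fun i hi => hxy i ?_]
  simp only [Finset.coe_range, Set.mem_Iio, Finset.mem_range] at hi ⊢
  omega

theorem measurable_partialSups_sum {φ : ℝ → ℝ} (hφ : Measurable φ) (n : ℕ) :
    Measurable (fun y : ℕ → ℝ => partialSups (fun v => φ (∑ i ∈ Finset.range v, y i)) n) :=
  measurable_partialSups_comp (fun v => hφ.comp (by fun_prop)) n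

theorem memLp_partialSups {Ω : Type*} [MeasurableSpace Ω] {μ : Measure Ω} {p : ENNReal}
    {f : ℕ → Ω → ℝ} (hf : ∀ v, MemLp (f v) p μ) (n : ℕ) :
    MemLp (fun ω => partialSups (fun v => f v ω) n) p μ := by
  induction n with
  | zero => simpa using hf 0
  | succ n ih =>
    simp only [partialSups_add_one]
    exact ih.sup (hf (n + 1))

theorem indepFun_partialSups {Ω : Type*} [MeasurableSpace Ω] {μ : Measure Ω}
    {Y : ℕ → Ω → ℝ} (hY : iIndepFun Y μ) (hm : ∀ i, Measurable (Y i)) {φ χ ψ : ℝ → ℝ}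
    (hφ : Measurable φ) (hχ : Measurable χ) (hψ : Measurable ψ) (n : ℕ) :
    IndepFun (fun ω => partialSups (fun v => φ (∑ i ∈ Finset.range v, Y i ω)) n *
      χ (∑ i ∈ Finset.range n, Y i ω)) (fun ω => ψ (Y n ω)) μ := by
  refine indepFun_comp_of_dependsOn hY hm (S := Finset.range n) (T := {n}) (by simp)
    (Φ := fun y => partialSups (fun v => φ (∑ i ∈ Finset.range v, y i)) n *
      χ (∑ i ∈ Finset.range n, y i)) (Ψ := fun y => ψ (y n))
    ((measurable_partialSups_sum hφ n).mul (hχ.comp (by fun_prop))) (by fun_prop) ?_ ?_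
  · intro x y hxy
    have h1 := dependsOn_partialSups φ n hxy
    have h2 : ∑ i ∈ Finset.range n, x i = ∑ i ∈ Finset.range n, y i :=
      Finset.sum_congr rfl fun i hi => hxy i (by simpa using hi)
    simp only at h1 ⊢
    rw [h1, h2]
  · intro x y hxy
    simp only
    rw [hxy n (by simp)]

theorem integral_partialSups_sum_sq_le {Ω : Type*} [MeasurableSpace Ω] {μ : Measure Ω}
    [IsProbabilityMeasure μ] {Y : ℕ → Ω → ℝ} (hY : iIndepFun Y μ) (hm : ∀ i, Measurable (Y i))
    (hL : ∀ i, MemLp (Y i) 2 μ) (h0 : ∀ i, ∫ ω, Y i ω ∂μ = 0) {V : ℝ}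
    (hV : ∀ i, ∫ ω, Y i ω ^ 2 ∂μ ≤ V) (n : ℕ) :
    Integrable (fun ω => (partialSups (fun v => ∑ i ∈ Finset.range v, Y i ω) n) ^ 2) μ ∧
    ∫ ω, (partialSups (fun v => ∑ i ∈ Finset.range v, Y i ω) n) ^ 2 ∂μ ≤ 4 * (n * V) := by
  have hS : ∀ v, MemLp (fun ω => ∑ i ∈ Finset.range v, Y i ω) 2 μ := fun v =>
    memLp_finsetSum _ fun i _ => hL i
  have hP := fun v => memLp_partialSups hS v
  have hI : ∀ i, Integrable (fun ω => partialSups (fun v => ∑ i ∈ Finset.range v, Y i ω) i *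
      (∑ j ∈ Finset.range (i + 1), Y j ω - ∑ j ∈ Finset.range i, Y j ω)) μ := fun i =>
    (hP i).integrable_mul ((hS (i + 1)).sub (hS i))
  refine ⟨(hP n).integrable_sq, ?_⟩
  refine (integral_partialSups_sq_le (f := fun v ω => ∑ i ∈ Finset.range v, Y i ω)
    (hP n).integrable_sq (hS n).integrable_sq (fun i _ => hI i) fun i _ => ?_).trans ?_
  · have := (indepFun_partialSups hY hm (φ := id) (χ := fun _ => 1) (ψ := id) measurable_id
      measurable_const measurable_id i).integral_fun_mul_eq_mul_integral
      (by simpa using (hP i).1) (hL i).1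
    simp only [id, mul_one, h0, mul_zero] at this
    simp only [Finset.sum_range_succ, add_sub_cancel_left]
    rw [this]
  · have h1 : ∫ ω, (∑ i ∈ Finset.range n, Y i ω) ^ 2 ∂μ =
        variance (fun ω => ∑ i ∈ Finset.range n, Y i ω) μ := by
      rw [variance_of_integral_eq_zero (hS n).1.aemeasurable]
      rw [integral_finsetSum _ fun i _ => (hL i).integrable (by norm_num)]
      simp [h0]
    have h2 : variance (∑ i ∈ Finset.range n, Y i) μ = ∑ i ∈ Finset.range n, variance (Y i) μ :=
      IndepFun.variance_sum (fun i _ => hL i) fun i _ j _ hij => hY.indepFun hij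
    have h3 : (fun ω => ∑ i ∈ Finset.range n, Y i ω) = ∑ i ∈ Finset.range n, Y i := by
      ext ω; simp
    rw [h1, h3, h2]
    have h4 : ∑ i ∈ Finset.range n, variance (Y i) μ ≤ ∑ i ∈ Finset.range n, V :=
      Finset.sum_le_sum fun i _ => by
        rw [variance_of_integral_eq_zero (hm i).aemeasurable (h0 i)]
        exact hV i
    simp at h4
    linarith

theorem partialSups_sq_le (s : ℕ → ℝ) (n : ℕ) :
    partialSups (fun v => s v ^ 2) n ≤
      (partialSups s n) ^ 2 + (partialSups (fun v => -s v) n) ^ 2 := by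
  refine partialSups_le _ _ _ fun v hv => ?_
  have h1 := le_partialSups_of_le s hv
  have h2 := le_partialSups_of_le (fun v => -s v) hv
  rcases le_total 0 (s v) with h | h
  · nlinarith [sq_nonneg (partialSups (fun v => -s v) n)]
  · nlinarith [sq_nonneg (partialSups s n)]

theorem integral_partialSups_sq_sum_le {Ω : Type*} [MeasurableSpace Ω] {μ : Measure Ω}
    [IsProbabilityMeasure μ] {Y : ℕ → Ω → ℝ} (hY : iIndepFun Y μ) (hm : ∀ i, Measurable (Y i))
    (hL : ∀ i, MemLp (Y i) 2 μ) (h0 : ∀ i, ∫ ω, Y i ω ∂μ = 0) {V : ℝ}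
    (hV : ∀ i, ∫ ω, Y i ω ^ 2 ∂μ ≤ V) (n : ℕ) :
    Integrable (fun ω => partialSups (fun v => (∑ i ∈ Finset.range v, Y i ω) ^ 2) n) μ ∧
    ∫ ω, partialSups (fun v => (∑ i ∈ Finset.range v, Y i ω) ^ 2) n ∂μ ≤ 8 * (n * V) := by
  have hYn : iIndepFun (fun i ω => -Y i ω) μ := hY.comp (fun _ => Neg.neg) fun _ => measurable_neg
  obtain ⟨i1, e1⟩ := integral_partialSups_sum_sq_le hY hm hL h0 hV n
  obtain ⟨i2, e2⟩ := integral_partialSups_sum_sq_le hYn (fun i => (hm i).neg)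
    (fun i => (hL i).neg) (fun i => by rw [integral_neg, h0 i, neg_zero]) (V := V)
    (by simpa using hV) n
  simp only [Finset.sum_neg_distrib] at i2 e2
  have hb : ∀ ω, partialSups (fun v => (∑ i ∈ Finset.range v, Y i ω) ^ 2) n ≤
      (partialSups (fun v => ∑ i ∈ Finset.range v, Y i ω) n) ^ 2 +
      (partialSups (fun v => -∑ i ∈ Finset.range v, Y i ω) n) ^ 2 := fun ω =>
    partialSups_sq_le (fun v => ∑ i ∈ Finset.range v, Y i ω) n
  have hnn : ∀ ω, 0 ≤ partialSups (fun v => (∑ i ∈ Finset.range v, Y i ω) ^ 2) n := fun ω =>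
    le_trans (by positivity) (le_partialSups_of_le _ (Nat.zero_le n))
  have hint : Integrable (fun ω => partialSups (fun v => (∑ i ∈ Finset.range v, Y i ω) ^ 2) n) μ := by
    refine (i1.add i2).mono' ?_ (ae_of_all _ fun ω => ?_)
    · exact (measurable_partialSups_comp (f := fun v ω => (∑ i ∈ Finset.range v, Y i ω) ^ 2)
        (fun v => by fun_prop) n).aestronglyMeasurable
    · rw [Real.norm_of_nonneg (hnn ω)]
      exact hb ω
  refine ⟨hint, (integral_mono hint (i1.add i2) hb).trans ?_⟩
  simp only [Pi.add_apply]
  rw [integral_add i1 i2]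
  linarith

theorem exp_le_one_add_add_sq {x κ : ℝ} (hx : |x| ≤ κ) (hκ : κ ≤ 1) :
    Real.exp x ≤ 1 + x + (1 + κ) / 2 * x ^ 2 := by
  have h := Real.exp_bound (hx.trans hκ) (n := 3) (by norm_num)
  simp only [Finset.sum_range_succ, Finset.sum_range_zero] at h
  norm_num [Nat.factorial] at h
  have h1 := (abs_le.1 h).2
  have h2 : |x| ^ 3 ≤ κ * x ^ 2 := by
    rw [pow_succ, sq_abs, mul_comm]
    exact mul_le_mul_of_nonneg_right hx (sq_nonneg x)
  nlinarith [abs_nonneg x, pow_nonneg (abs_nonneg x) 3]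

theorem integrable_exp_of_bounded {Ω : Type*} [MeasurableSpace Ω] {μ : Measure Ω}
    [IsProbabilityMeasure μ] {Y : Ω → ℝ} (hm : Measurable Y) {B : ℝ} (hB : ∀ ω, |Y ω| ≤ B)
    (l : ℝ) : Integrable (fun ω => Real.exp (l * Y ω)) μ := by
  refine Integrable.of_bound (by fun_prop) (Real.exp (|l| * B)) (ae_of_all _ fun ω => ?_)
  rw [Real.norm_of_nonneg (Real.exp_pos _).le]
  refine Real.exp_le_exp.2 ((le_abs_self _).trans ?_)
  rw [abs_mul]
  exact mul_le_mul_of_nonneg_left (hB ω) (abs_nonneg l)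

theorem mgf_le_exp_of_bounded {Ω : Type*} [MeasurableSpace Ω] {μ : Measure Ω}
    [IsProbabilityMeasure μ] {Y : Ω → ℝ} (hm : Measurable Y) {B κ l : ℝ} (hB : ∀ ω, |Y ω| ≤ B)
    (h0 : ∫ ω, Y ω ∂μ = 0) (hV : ∫ ω, Y ω ^ 2 ∂μ ≤ 1) (hl : |l| * B ≤ κ) (hκ0 : 0 ≤ κ)
    (hκ : κ ≤ 1) :
    1 ≤ mgf Y μ l ∧ mgf Y μ l ≤ Real.exp (l ^ 2 * (1 + κ) / 2) := by
  have hY : Integrable Y μ := Integrable.of_bound hm.aestronglyMeasurable B (ae_of_all _ hB)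
  have hY2 : Integrable (fun ω => Y ω ^ 2) μ := by
    refine Integrable.of_bound (by fun_prop) (B ^ 2) (ae_of_all _ fun ω => ?_)
    rw [Real.norm_of_nonneg (sq_nonneg _), ← sq_abs]
    exact pow_le_pow_left₀ (abs_nonneg _) (hB ω) 2
  have hE := integrable_exp_of_bounded (μ := μ) hm hB l
  constructor
  · have := integral_mono ((integrable_const (1 : ℝ)).add (hY.const_mul l)) hE fun ω => by
      simpa [add_comm] using Real.add_one_le_exp (l * Y ω)
    simp only [Pi.add_apply] at this
    rw [integral_add (integrable_const _) (hY.const_mul l), integral_const_mul, h0] at this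
    simpa [mgf] using this
  · have hi := ((integrable_const (1 : ℝ)).add (hY.const_mul l)).add
      (hY2.const_mul ((1 + κ) / 2 * l ^ 2))
    have := integral_mono hE hi fun ω => by
      have hx : |l * Y ω| ≤ κ := by
        rw [abs_mul]
        exact (mul_le_mul_of_nonneg_left (hB ω) (abs_nonneg l)).trans hl
      have := exp_le_one_add_add_sq hx hκ
      simp only [Pi.add_apply]
      nlinarith
    simp only [Pi.add_apply] at this
    rw [integral_add (f := fun x => 1 + l * Y x) ((integrable_const _).add (hY.const_mul l))
      (hY2.const_mul _), integral_add (integrable_const _) (hY.const_mul l), integral_const_mul, integral_const_mul,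
      h0] at this
    simp only [integral_const, probReal_univ, smul_eq_mul] at this
    refine (show mgf Y μ l ≤ _ from this).trans (le_trans ?_ (Real.add_one_le_exp _))
    nlinarith [mul_le_mul_of_nonneg_left hV (show 0 ≤ (1 + κ) / 2 * l ^ 2 by positivity)]

theorem integral_partialSups_exp_sq_le {Ω : Type*} [MeasurableSpace Ω] {μ : Measure Ω}
    [IsProbabilityMeasure μ] {Y : ℕ → Ω → ℝ} (hY : iIndepFun Y μ) (hm : ∀ i, Measurable (Y i))
    {B κ l : ℝ} (hB : ∀ i ω, |Y i ω| ≤ B) (h0 : ∀ i, ∫ ω, Y i ω ∂μ = 0)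
    (hV : ∀ i, ∫ ω, Y i ω ^ 2 ∂μ ≤ 1) (hl : |l| * B ≤ κ) (hκ0 : 0 ≤ κ) (hκ : κ ≤ 1) (n : ℕ) :
    Integrable (fun ω =>
      (partialSups (fun v => Real.exp (l / 2 * ∑ i ∈ Finset.range v, Y i ω)) n) ^ 2) μ ∧
    ∫ ω, (partialSups (fun v => Real.exp (l / 2 * ∑ i ∈ Finset.range v, Y i ω)) n) ^ 2 ∂μ ≤
      4 * Real.exp (l ^ 2 * (1 + κ) / 2 * n) := by
  have hB0 : 0 ≤ B := by
    obtain ⟨ω⟩ : Nonempty Ω := nonempty_of_isProbabilityMeasure μ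
    exact (abs_nonneg _).trans (hB 0 ω)
  have hl2 : |l / 2| * B ≤ κ := by
    rw [abs_div, abs_two]
    nlinarith [abs_nonneg l, mul_nonneg (abs_nonneg l) hB0]
  set f : ℕ → Ω → ℝ := fun v ω => Real.exp (l / 2 * ∑ i ∈ Finset.range v, Y i ω) with hf
  have hSB : ∀ v ω, |∑ i ∈ Finset.range v, Y i ω| ≤ v * B := fun v ω => by
    refine (Finset.abs_sum_le_sum_abs _ _).trans ((Finset.sum_le_sum fun i _ => hB i ω).trans ?_)
    simp
  have hfm : ∀ v, Measurable (f v) := fun v => by simp only [hf]; fun_prop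
  have hL : ∀ v, MemLp (f v) 2 μ := fun v => by
    refine MemLp.of_bound (hfm v).aestronglyMeasurable (Real.exp (|l / 2| * (v * B)))
      (ae_of_all _ fun ω => ?_)
    rw [Real.norm_of_nonneg (Real.exp_pos _).le]
    refine Real.exp_le_exp.2 ((le_abs_self _).trans ?_)
    rw [abs_mul]
    exact mul_le_mul_of_nonneg_left (hSB v ω) (abs_nonneg _)
  have hP := fun v => memLp_partialSups hL v
  have hI : ∀ i, Integrable (fun ω => partialSups (fun v => f v ω) i * (f (i + 1) ω - f i ω)) μ :=
    fun i => (hP i).integrable_mul ((hL (i + 1)).sub (hL i))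
  refine ⟨(hP n).integrable_sq, ?_⟩
  refine (integral_partialSups_sq_le (f := f) (hP n).integrable_sq (hL n).integrable_sq
    (fun i _ => hI i) fun i _ => ?_).trans ?_
  · have hint := indepFun_partialSups hY hm (φ := fun x => Real.exp (l / 2 * x))
      (χ := fun x => Real.exp (l / 2 * x)) (ψ := fun x => Real.exp (l / 2 * x) - 1)
      (by fun_prop) (by fun_prop) (by fun_prop) i
    have hy := integrable_exp_of_bounded (μ := μ) (hm i) (hB i) (l / 2)
    have := hint.integral_fun_mul_eq_mul_integral
      (((hP i).integrable_mul (hL i)).aestronglyMeasurable)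
      (hy.sub (integrable_const 1)).aestronglyMeasurable
    have e : ∀ ω, partialSups (fun v => f v ω) i * (f (i + 1) ω - f i ω) =
        partialSups (fun v => Real.exp (l / 2 * ∑ i ∈ Finset.range v, Y i ω)) i *
        Real.exp (l / 2 * ∑ i ∈ Finset.range i, Y i ω) * (Real.exp (l / 2 * Y i ω) - 1) := by
      intro ω
      simp only [hf, Finset.sum_range_succ, mul_add, Real.exp_add]
      ring
    simp only [e]
    rw [this]
    refine mul_nonneg (integral_nonneg fun ω => mul_nonneg ?_ (Real.exp_pos _).le) ?_
    · exact le_trans (Real.exp_pos _).le (le_partialSups_of_le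
        (fun v => Real.exp (l / 2 * ∑ i ∈ Finset.range v, Y i ω)) (Nat.zero_le i))
    · rw [integral_sub hy (integrable_const 1)]
      have := (mgf_le_exp_of_bounded (hm i) (hB i) (h0 i) (hV i) hl2 hκ0 hκ).1
      simp only [mgf] at this
      simpa using this
  · refine mul_le_mul_of_nonneg_left ?_ (by norm_num)
    have e : ∀ ω, f n ω ^ 2 = Real.exp (l * (∑ i ∈ Finset.range n, Y i) ω) := fun ω => by
      simp only [hf, ← Real.exp_nat_mul, Finset.sum_apply]
      congr 1
      push_cast
      ring
    simp only [e]
    change mgf (∑ i ∈ Finset.range n, Y i) μ l ≤ _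
    rw [hY.mgf_sum hm]
    refine (Finset.prod_le_prod (fun i _ => mgf_nonneg) fun i _ =>
      (mgf_le_exp_of_bounded (hm i) (hB i) (h0 i) (hV i) hl hκ0 hκ).2).trans ?_
    rw [Finset.prod_const, Finset.card_range, ← Real.exp_nat_mul]
    exact Real.exp_le_exp.2 (by linarith)

theorem sq_sub_sq_le_exp {s t l : ℝ} (hl : 0 < l) (ht : 0 ≤ t) :
    max (s ^ 2 - t ^ 2) 0 ≤ (2 / l ^ 2 + 2 * t / l) * Real.exp (-(l * t)) *
      (Real.exp (l / 2 * s) ^ 2 + Real.exp (-l / 2 * s) ^ 2) := by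
  have hc : 0 ≤ 2 / l ^ 2 + 2 * t / l := by positivity
  refine max_le ?_ (by positivity)
  have h1 : Real.exp (l * |s|) ≤ Real.exp (l / 2 * s) ^ 2 + Real.exp (-l / 2 * s) ^ 2 := by
    simp only [← Real.exp_nat_mul]
    rcases abs_cases s with ⟨h, -⟩ | ⟨h, -⟩ <;> rw [h]
    · have : ((2 : ℕ) : ℝ) * (l / 2 * s) = l * s := by push_cast; ring
      rw [this]
      linarith [Real.exp_pos (((2 : ℕ) : ℝ) * (-l / 2 * s))]
    · have : ((2 : ℕ) : ℝ) * (-l / 2 * s) = l * -s := by push_cast; ring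
      rw [this]
      linarith [Real.exp_pos (((2 : ℕ) : ℝ) * (l / 2 * s))]
  refine le_trans ?_ (mul_le_mul_of_nonneg_left h1 (by positivity))
  rw [mul_assoc, ← Real.exp_add]
  rcases le_total |s| t with hst | hst
  · have : s ^ 2 - t ^ 2 ≤ 0 := by
      rw [← sq_abs]
      nlinarith [abs_nonneg s]
    exact this.trans (by positivity)
  · set u := |s| - t with hu
    have hu0 : 0 ≤ u := sub_nonneg.2 hst
    have h2 : -(l * t) + l * |s| = l * u := by rw [hu]; ring
    rw [h2]
    have h3 := Real.quadratic_le_exp_of_nonneg (show 0 ≤ l * u by positivity)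
    have h4 : s ^ 2 - t ^ 2 = u ^ 2 + 2 * t * u := by rw [← sq_abs s, hu]; ring
    rw [h4]
    refine le_trans ?_ (mul_le_mul_of_nonneg_left h3 hc)
    have h5 : (2 / l ^ 2 + 2 * t / l) * (1 + l * u + (l * u) ^ 2 / 2) =
        u ^ 2 + 2 * t * u + (2 / l ^ 2 + 2 * t / l + 2 * u / l + t * l * u ^ 2) := by
      field_simp
      ring
    rw [h5]
    have : 0 ≤ 2 / l ^ 2 + 2 * t / l + 2 * u / l + t * l * u ^ 2 := by positivity
    linarith

/-- The expected excess of the squared partial sums over the level `2 (1 + 2κ) T s` is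
exponentially small in `T`, with a rate better than one. -/
theorem integral_partialSups_excess_le {Ω : Type*} [MeasurableSpace Ω] {μ : Measure Ω}
    [IsProbabilityMeasure μ] {Y : ℕ → Ω → ℝ} (hY : iIndepFun Y μ) (hm : ∀ i, Measurable (Y i))
    {B κ T s : ℝ} (hB : ∀ i ω, |Y i ω| ≤ B) (h0 : ∀ i, ∫ ω, Y i ω ∂μ = 0)
    (hV : ∀ i, ∫ ω, Y i ω ^ 2 ∂μ ≤ 1) (hκ0 : 0 < κ) (hκ : κ ≤ 1 / 4) (hT : 1 ≤ T) (hs : 0 < s)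
    (hl : √(2 * (1 + 2 * κ) * T / s) * B ≤ κ) {n : ℕ} (hn : n ≤ s) :
    Integrable (fun ω => partialSups (fun v =>
      max ((∑ i ∈ Finset.range v, Y i ω) ^ 2 - 2 * (1 + 2 * κ) * T * s) 0) n) μ ∧
    ∫ ω, partialSups (fun v =>
      max ((∑ i ∈ Finset.range v, Y i ω) ^ 2 - 2 * (1 + 2 * κ) * T * s) 0) n ∂μ ≤
        32 * s * Real.exp (-((1 + κ / 2) * T)) := by
  set c := 2 * (1 + 2 * κ) with hc
  have hc2 : 2 ≤ c := by linarith
  set l := √(c * T / s) with hldef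
  have hl0 : 0 < l := Real.sqrt_pos.2 (by positivity)
  have hlsq : l ^ 2 = c * T / s := Real.sq_sqrt (by positivity)
  set t := l * s with ht
  have htsq : t ^ 2 = c * T * s := by rw [ht, mul_pow, hlsq]; field_simp
  have hlt : l * t = c * T := by rw [ht, ← mul_assoc, ← sq, hlsq]; field_simp
  set D := (2 / l ^ 2 + 2 * t / l) * Real.exp (-(l * t)) with hD
  have hD0 : 0 ≤ D := by positivity
  have hDle : D ≤ 4 * s * Real.exp (-(c * T)) := by
    rw [hD, hlt]
    refine mul_le_mul_of_nonneg_right ?_ (Real.exp_pos _).le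
    have e1 : 2 * t / l = 2 * s := by rw [ht]; field_simp
    have e2 : 2 / l ^ 2 ≤ 2 * s := by
      rw [hlsq, div_div_eq_mul_div, div_le_iff₀ (by positivity)]
      nlinarith [mul_pos hs (show 0 < T by linarith), mul_le_mul hc2 hT (by norm_num) (by linarith)]
    linarith
  obtain ⟨i1, e1⟩ := integral_partialSups_exp_sq_le hY hm hB h0 hV (l := l)
    (by rwa [abs_of_pos hl0]) hκ0.le (by linarith) n
  obtain ⟨i2, e2⟩ := integral_partialSups_exp_sq_le hY hm hB h0 hV (l := -l)
    (by rwa [abs_neg, abs_of_pos hl0]) hκ0.le (by linarith) n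
  have hb : ∀ ω, partialSups (fun v =>
      max ((∑ i ∈ Finset.range v, Y i ω) ^ 2 - c * T * s) 0) n ≤
      D * ((partialSups (fun v => Real.exp (l / 2 * ∑ i ∈ Finset.range v, Y i ω)) n) ^ 2 +
        (partialSups (fun v => Real.exp (-l / 2 * ∑ i ∈ Finset.range v, Y i ω)) n) ^ 2) := by
    intro ω
    refine partialSups_le _ _ _ fun v hv => ?_
    rw [← htsq]
    refine (sq_sub_sq_le_exp hl0 (by positivity)).trans (mul_le_mul_of_nonneg_left ?_ hD0)
    exact add_le_add
      (pow_le_pow_left₀ (Real.exp_pos _).le (le_partialSups_of_le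
        (fun v => Real.exp (l / 2 * ∑ i ∈ Finset.range v, Y i ω)) hv) 2)
      (pow_le_pow_left₀ (Real.exp_pos _).le (le_partialSups_of_le
        (fun v => Real.exp (-l / 2 * ∑ i ∈ Finset.range v, Y i ω)) hv) 2)
  have hi := (i1.add i2).const_mul D
  have hint : Integrable (fun ω => partialSups (fun v =>
      max ((∑ i ∈ Finset.range v, Y i ω) ^ 2 - c * T * s) 0) n) μ := by
    refine hi.mono' ?_ (ae_of_all _ fun ω => ?_)
    · exact (measurable_partialSups_comp
        (f := fun v ω => max ((∑ i ∈ Finset.range v, Y i ω) ^ 2 - c * T * s) 0)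
        (fun v => by fun_prop) n).aestronglyMeasurable
    · rw [Real.norm_of_nonneg (le_trans (le_max_right _ _) (le_partialSups_of_le
        (fun v => max ((∑ i ∈ Finset.range v, Y i ω) ^ 2 - c * T * s) 0) (Nat.zero_le n)))]
      exact hb ω
  refine ⟨hint, (integral_mono hint hi hb).trans ?_⟩
  rw [integral_const_mul]
  simp only [Pi.add_apply]
  rw [integral_add i1 i2]
  rw [neg_sq] at e2
  have h3 : Real.exp (l ^ 2 * (1 + κ) / 2 * n) ≤ Real.exp (c * T * (1 + κ) / 2) := by
    refine Real.exp_le_exp.2 ?_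
    have : c * T * (1 + κ) / 2 = l ^ 2 * (1 + κ) / 2 * s := by rw [hlsq]; field_simp
    rw [this]
    exact mul_le_mul_of_nonneg_left hn (by positivity)
  calc D * _ ≤ D * (8 * Real.exp (c * T * (1 + κ) / 2)) :=
        mul_le_mul_of_nonneg_left (by linarith) hD0
    _ ≤ 4 * s * Real.exp (-(c * T)) * (8 * Real.exp (c * T * (1 + κ) / 2)) :=
        mul_le_mul_of_nonneg_right hDle (by positivity)
    _ = 32 * s * Real.exp (-(c * T) + c * T * (1 + κ) / 2) := by rw [Real.exp_add]; ring
    _ ≤ 32 * s * Real.exp (-((1 + κ / 2) * T)) := by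
        refine mul_le_mul_of_nonneg_left (Real.exp_le_exp.2 ?_) (by positivity)
        rw [hc]
        nlinarith [mul_nonneg hκ0.le (show 0 ≤ T by linarith),
          mul_nonneg (mul_nonneg hκ0.le (show 0 ≤ T by linarith)) (show 0 ≤ 1 / 4 - κ by linarith)]

theorem exists_truncation {Ω : Type*} [MeasurableSpace Ω] {μ : Measure Ω}
    [IsProbabilityMeasure μ] {Y : Ω → ℝ} (hm : Measurable Y) (h0 : ∫ ω, Y ω ∂μ = 0)
    (hL : MemLp Y 2 μ) (h1 : ∫ ω, Y ω ^ 2 ∂μ = 1) {δ : ℝ} (hδ : 0 < δ)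
    (hmom : Integrable (fun ω => |Y ω| ^ (2 + δ)) μ) {K : ℝ} (hK : 0 < K) :
    ∃ p : ℝ → ℝ, Measurable p ∧ (∀ x, |p x| ≤ 2 * K) ∧ ∫ ω, p (Y ω) ∂μ = 0 ∧
      ∫ ω, p (Y ω) ^ 2 ∂μ ≤ 1 ∧ MemLp (fun ω => Y ω - p (Y ω)) 2 μ ∧
      ∫ ω, (Y ω - p (Y ω)) ∂μ = 0 ∧
      ∫ ω, (Y ω - p (Y ω)) ^ 2 ∂μ ≤ (1 / K) ^ δ * ∫ ω, |Y ω| ^ (2 + δ) ∂μ := by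
  set u : ℝ → ℝ := fun x => if |x| ≤ K then x else 0 with hu
  have hum : Measurable u :=
    Measurable.ite (measurableSet_le (by fun_prop) measurable_const) measurable_id measurable_const
  have huK : ∀ x, |u x| ≤ K := fun x => by
    simp only [hu]
    split_ifs with h
    · exact h
    · simpa using hK.le
  have husq : ∀ x, u x ^ 2 ≤ x ^ 2 := fun x => by
    simp only [hu]
    split_ifs with h
    · exact le_rfl
    · simpa using sq_nonneg x
  set m : ℝ := ∫ ω, u (Y ω) ∂μ with hmdef
  have hmK : |m| ≤ K := by
    have := norm_integral_le_of_norm_le_const (μ := μ) (f := fun ω => u (Y ω)) (C := K)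
      (ae_of_all _ fun ω => huK (Y ω))
    simpa using this
  have huL : MemLp (fun ω => u (Y ω)) 2 μ :=
    MemLp.of_bound (hum.comp hm).aestronglyMeasurable K (ae_of_all _ fun ω => huK (Y ω))
  have hui : Integrable (fun ω => u (Y ω)) μ := huL.integrable (by norm_num)
  have hYi : Integrable Y μ := hL.integrable (by norm_num)
  have hvar : ∀ Z : Ω → ℝ, MemLp Z 2 μ → ∫ ω, (Z ω - ∫ ω', Z ω' ∂μ) ^ 2 ∂μ ≤ ∫ ω, Z ω ^ 2 ∂μ := by
    intro Z hZ
    rw [← variance_eq_integral hZ.1.aemeasurable]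
    exact variance_le_expectation_sq hZ.1
  have hvm : ∫ ω, (Y ω - u (Y ω)) ∂μ = -m := by rw [integral_sub hYi hui, h0, ← hmdef, zero_sub]
  have hpm : ∫ ω, (u (Y ω) - m) ∂μ = 0 := by
    rw [integral_sub hui (integrable_const m)]
    simp [hmdef]
  refine ⟨fun x => u x - m, by fun_prop, fun x => ?_, hpm, ?_, ?_, ?_, ?_⟩
  · exact (abs_sub _ _).trans (by linarith [huK x])
  · refine (hvar _ huL).trans ?_
    rw [← h1]
    exact integral_mono huL.integrable_sq hL.integrable_sq fun ω => husq (Y ω)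
  · exact hL.sub (huL.sub (memLp_const m))
  · have := integral_sub hYi (g := fun ω => u (Y ω) - m) (hui.sub (integrable_const m))
    rw [hpm, h0, sub_zero] at this
    exact this
  · have e : ∀ ω, Y ω - (u (Y ω) - m) = (Y ω - u (Y ω)) - ∫ ω', (Y ω' - u (Y ω')) ∂μ := by
      intro ω; rw [hvm]; ring
    simp only [e]
    refine (hvar _ (hL.sub huL)).trans ?_
    rw [← integral_const_mul]
    refine integral_mono (hL.sub huL).integrable_sq (hmom.const_mul _) fun ω => ?_
    simp only [hu, Pi.sub_apply]
    split_ifs with h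
    · simp only [sub_self, ne_eq, OfNat.ofNat_ne_zero, not_false_eq_true, zero_pow]
      positivity
    · push Not at h
      have hpos : 0 < |Y ω| := hK.trans h
      rw [sub_zero, Real.rpow_add hpos, ← sq_abs, Real.rpow_two]
      have : 1 ≤ (1 / K) ^ δ * |Y ω| ^ δ := by
        rw [← Real.mul_rpow (by positivity) (abs_nonneg _)]
        refine Real.one_le_rpow ?_ hδ.le
        rw [one_div_mul_eq_div, le_div_iff₀ hK]
        linarith
      nlinarith [sq_nonneg |Y ω|]

theorem add_sq_le_of_pos {x y κ : ℝ} (hκ : 0 < κ) :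
    (x + y) ^ 2 ≤ (1 + κ) * x ^ 2 + (1 + 1 / κ) * y ^ 2 := by
  have : (1 + κ) * x ^ 2 + (1 + 1 / κ) * y ^ 2 - (x + y) ^ 2 = (κ * x - y) ^ 2 / κ := by
    field_simp
    ring
  have h2 : 0 ≤ (κ * x - y) ^ 2 / κ := by positivity
  linarith

/-- A sequence of independent standardized random variables with a common law having an absolute
moment of order `2 + δ`. -/
structure IsStandardIID {Ω : Type*} [MeasurableSpace Ω] (μ : Measure Ω) (X : ℕ → Ω → ℝ)
    (δ : ℝ) : Prop where
  indep : iIndepFun X μ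
  meas : ∀ i, Measurable (X i)
  ident : ∀ i, IdentDistrib (X i) (X 0) μ μ
  memLp : MemLp (X 0) 2 μ
  mean : ∫ ω, X 0 ω ∂μ = 0
  sq : ∫ ω, X 0 ω ^ 2 ∂μ = 1
  moment : Integrable (fun ω => |X 0 ω| ^ (2 + δ)) μ

section
variable {Ω : Type*} [MeasurableSpace Ω] {μ : Measure Ω} [IsProbabilityMeasure μ]
  {X : ℕ → Ω → ℝ} {δ : ℝ}

/-- Squared partial sums up to time `n ≤ s` exceed a level slightly above `2 T s` only by an error
of small expectation. -/
theorem IsStandardIID.exists_excess_bound (hX : IsStandardIID μ X δ) (hδ : 0 < δ) {κ : ℝ}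
    (hκ0 : 0 < κ) (hκ : κ ≤ 1 / 4) :
    ∃ C, 0 ≤ C ∧ ∀ T s : ℝ, 1 ≤ T → 0 < s → ∀ n : ℕ, (n : ℝ) ≤ s →
      ∃ g : (ℕ → ℝ) → ℝ, Measurable g ∧ (∀ x, 0 ≤ g x) ∧
        (∀ x, ∀ v ≤ n, (∑ i ∈ Finset.range v, x i) ^ 2 ≤
          (1 + κ) * (2 * (1 + 2 * κ)) * T * s + g x) ∧
        Integrable (fun ω => g fun i => X i ω) μ ∧
        ∫ ω, g (fun i => X i ω) ∂μ ≤
          C * s * (Real.exp (-((1 + κ / 2) * T)) + √(T / s) ^ δ) := by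
  set c := 2 * (1 + 2 * κ) with hc
  have hc0 : 0 < c := by positivity
  set A := ∫ ω, |X 0 ω| ^ (2 + δ) ∂μ with hA
  have hA0 : 0 ≤ A := integral_nonneg fun ω => by positivity
  set κ' := κ / (2 * √c) with hκ'
  have hκ'0 : 0 < κ' := by positivity
  set D := (1 + 1 / κ) * 8 * ((1 / κ') ^ δ * A) with hD
  have hD0 : 0 ≤ D := by positivity
  refine ⟨(1 + κ) * 32 + D, by positivity, fun T s hT hs n hn => ?_⟩
  have hr : 0 < √(T / s) := Real.sqrt_pos.2 (by positivity)
  obtain ⟨p, hpm, hpB, hp0, hp1, hqL, hq0, hq2⟩ := exists_truncation (hX.meas 0) hX.mean hX.memLp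
    hX.sq hδ hX.moment (K := κ' / √(T / s)) (by positivity)
  have hid : ∀ (f : ℝ → ℝ), Measurable f → ∀ i,
      IdentDistrib (fun ω => f (X i ω)) (fun ω => f (X 0 ω)) μ μ := fun f hf i =>
    (hX.ident i).comp hf
  have hq : Measurable fun x => x - p x := by fun_prop
  obtain ⟨i1, e1⟩ := integral_partialSups_excess_le (Y := fun i ω => p (X i ω)) (μ := μ)
    (hX.indep.comp (fun _ => p) fun _ => hpm) (fun i => hpm.comp (hX.meas i))
    (B := 2 * (κ' / √(T / s))) (κ := κ) (T := T) (s := s) (fun i ω => hpB _)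
    (fun i => (hid p hpm i).integral_eq.trans hp0)
    (fun i => (hid (fun x => p x ^ 2) (by fun_prop) i).integral_eq.trans_le hp1) hκ0 hκ hT hs
    (by
      rw [← hc, mul_div_assoc, Real.sqrt_mul hc0.le, hκ']
      field_simp
      exact le_rfl) hn
  obtain ⟨i2, e2⟩ := integral_partialSups_sq_sum_le (Y := fun i ω => X i ω - p (X i ω)) (μ := μ)
    (hX.indep.comp (fun _ x => x - p x) fun _ => hq) (fun i => hq.comp (hX.meas i))
    (fun i => (hid _ hq i).memLp_iff.2 hqL)
    (fun i => (hid _ hq i).integral_eq.trans hq0)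
    (fun i => (hid (fun x => (x - p x) ^ 2) (by fun_prop) i).integral_eq.trans_le hq2) n
  set g1 : (ℕ → ℝ) → ℝ := fun x => partialSups (fun v =>
      max ((∑ i ∈ Finset.range v, p (x i)) ^ 2 - c * T * s) 0) n with hg1
  set g2 : (ℕ → ℝ) → ℝ := fun x => partialSups (fun v =>
      (∑ i ∈ Finset.range v, (x i - p (x i))) ^ 2) n with hg2
  have h1 : ∀ x, ∀ v ≤ n, (∑ i ∈ Finset.range v, p (x i)) ^ 2 - c * T * s ≤ g1 x := fun x v hv =>
    (le_max_left _ _).trans (le_partialSups_of_le (fun v =>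
      max ((∑ i ∈ Finset.range v, p (x i)) ^ 2 - c * T * s) 0) hv)
  have h2 : ∀ x, ∀ v ≤ n, (∑ i ∈ Finset.range v, (x i - p (x i))) ^ 2 ≤ g2 x := fun x v hv =>
    le_partialSups_of_le (fun v => (∑ i ∈ Finset.range v, (x i - p (x i))) ^ 2) hv
  have hn1 : ∀ x, 0 ≤ g1 x := fun x => (le_max_right _ _).trans (le_partialSups_of_le (fun v =>
      max ((∑ i ∈ Finset.range v, p (x i)) ^ 2 - c * T * s) 0) (Nat.zero_le n))
  have hn2 : ∀ x, 0 ≤ g2 x := fun x => (sq_nonneg _).trans (h2 x 0 (Nat.zero_le n))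
  refine ⟨fun x => (1 + κ) * g1 x + (1 + 1 / κ) * g2 x, ?_, fun x => ?_, fun x v hv => ?_, ?_, ?_⟩
  · refine ((measurable_partialSups_comp (fun v => ?_) n).const_mul _).add
      ((measurable_partialSups_comp (fun v => ?_) n).const_mul _)
    · fun_prop
    · fun_prop
  · have := hn1 x
    have := hn2 x
    positivity
  · have e : ∑ i ∈ Finset.range v, x i =
        ∑ i ∈ Finset.range v, p (x i) + ∑ i ∈ Finset.range v, (x i - p (x i)) := by
      rw [← Finset.sum_add_distrib]
      simp
    rw [e]
    refine (add_sq_le_of_pos hκ0).trans ?_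
    have a1 := mul_le_mul_of_nonneg_left (h1 x v hv) (show 0 ≤ 1 + κ by positivity)
    have a2 := mul_le_mul_of_nonneg_left (h2 x v hv) (show 0 ≤ 1 + 1 / κ by positivity)
    linarith
  · exact (i1.const_mul _).add (i2.const_mul _)
  · rw [integral_add (i1.const_mul _) (i2.const_mul _), integral_const_mul, integral_const_mul]
    have e3 : (1 / (κ' / √(T / s))) ^ δ = (1 / κ') ^ δ * √(T / s) ^ δ := by
      rw [← Real.mul_rpow (by positivity) hr.le]
      congr 1
      field_simp
    rw [e3] at e2
    set E := Real.exp (-((1 + κ / 2) * T)) with hE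
    have hE0 : 0 ≤ E := (Real.exp_pos _).le
    set R := √(T / s) ^ δ with hR
    have hR0 : 0 ≤ R := by positivity
    have a1 := mul_le_mul_of_nonneg_left e1 (show 0 ≤ 1 + κ by positivity)
    have a2 := mul_le_mul_of_nonneg_left e2 (show 0 ≤ 1 + 1 / κ by positivity)
    have a3 : (1 + 1 / κ) * (8 * (n * ((1 / κ') ^ δ * R * A))) = D * R * n := by
      rw [hD]; ring
    have a4 : D * R * n ≤ D * R * s := mul_le_mul_of_nonneg_left hn (by positivity)
    have a5 : 0 ≤ (1 + κ) * 32 * s * R := by positivity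
    have a6 : 0 ≤ D * s * E := by positivity
    have a7 : ((1 + κ) * 32 + D) * s * (E + R) =
      (1 + κ) * (32 * s * E) + D * R * s + (1 + κ) * 32 * s * R + D * s * E := by ring
    rw [a7]
    rw [a3] at a2
    linarith

theorem sum_Ico_eq_sum_range_reflect (f : ℕ → ℝ) (a x : ℕ) :
    ∑ i ∈ Finset.Ico a x, f i = ∑ i ∈ Finset.range (x - a), f (if i < x then x - 1 - i else i) := by
  refine Finset.sum_nbij' (fun i => x - 1 - i) (fun i => x - 1 - i) ?_ ?_ ?_ ?_ ?_
  · intro i hi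
    simp only [Finset.mem_Ico, Finset.mem_range] at hi ⊢
    omega
  · intro i hi
    simp only [Finset.mem_Ico, Finset.mem_range] at hi ⊢
    omega
  · intro i hi
    simp only [Finset.mem_Ico] at hi
    omega
  · intro i hi
    simp only [Finset.mem_range] at hi
    omega
  · intro i hi
    simp only [Finset.mem_Ico] at hi
    rw [if_pos (by omega)]
    congr 1
    omega

theorem quintic_le {κ : ℝ} (h0 : 0 ≤ κ) (h1 : κ ≤ 1 / 4) :
    (1 + κ) ^ 2 * (1 + 2 * κ) * (1 + κ + κ ^ 2) ≤ 1 + 20 * κ := by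
  have p1 : (1 + κ) ^ 2 ≤ 1 + 3 * κ := by nlinarith
  have p2 : (1 + κ) ^ 2 * (1 + 2 * κ) ≤ 1 + 7 * κ :=
    (mul_le_mul_of_nonneg_right p1 (by positivity)).trans (by nlinarith)
  have p3 : 1 + κ + κ ^ 2 ≤ 1 + 2 * κ := by nlinarith
  calc _ ≤ (1 + 7 * κ) * (1 + 2 * κ) := mul_le_mul p2 p3 (by positivity) (by positivity)
    _ ≤ 1 + 20 * κ := by nlinarith

/-- Squared sums over intervals of length comparable to `(1 + ε) ^ j` around a given point exceed
the level `c T (1 + ε) ^ j`, where `c > 2`, only by an error of small expectation. -/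
theorem IsStandardIID.exists_scale_bound (hX : IsStandardIID μ X δ) (hδ : 0 < δ) {c : ℝ}
    (hc : 2 < c) :
    ∃ κ ε C : ℝ, 0 < κ ∧ 0 < ε ∧ ε ≤ 1 / 2 ∧ 0 ≤ C ∧ ∀ T : ℝ, 1 ≤ T → ∀ j : ℕ,
      ∃ y : ℕ → Ω → ℝ, (∀ x ω, 0 ≤ y x ω) ∧ (∀ x, Integrable (y x) μ) ∧
        (∀ x, ∫ ω, y x ω ∂μ ≤
          C * (1 + ε) ^ j * (Real.exp (-((1 + κ) * T)) + √(T / (1 + ε) ^ j) ^ δ)) ∧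
        ∀ a x b : ℕ, a ≤ x → x ≤ b → ((x - a : ℕ) : ℝ) ≤ ε * (1 + ε) ^ j →
          ((b - x : ℕ) : ℝ) ≤ (1 + ε) ^ (j + 1) → ∀ ω,
          (∑ i ∈ Finset.Ico a b, X i ω) ^ 2 ≤ c * T * (1 + ε) ^ j + y x ω := by
  obtain ⟨κ, hκ0, hκ, hκc⟩ : ∃ κ : ℝ, 0 < κ ∧ κ ≤ 1 / 4 ∧ 40 * κ ≤ c - 2 :=
    ⟨min (1 / 4) ((c - 2) / 40), lt_min (by norm_num) (by linarith), min_le_left _ _, by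
      linarith [min_le_right (1 / 4) ((c - 2) / 40)]⟩
  obtain ⟨C, hC0, hC⟩ := hX.exists_excess_bound hδ hκ0 hκ
  set ε := κ ^ 2 with hε
  have hε0 : 0 < ε := by positivity
  have hε1 : ε ≤ 1 / 2 := by nlinarith
  set B := √(1 / ε) ^ δ with hB
  have hB1 : 1 ≤ B := by
    refine Real.one_le_rpow (Real.one_le_sqrt.2 ?_) hδ.le
    rw [le_div_iff₀ hε0]
    linarith
  refine ⟨κ / 2, ε, C * (2 * (1 + κ) + (1 + 1 / κ) * B), by positivity, hε0, hε1, by positivity,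
    fun T hT j => ?_⟩
  set r := (1 + ε) ^ j with hr
  have hr0 : 0 < r := by positivity
  have hnR : (⌊(1 + ε) * r⌋₊ : ℝ) ≤ (1 + ε) * r := Nat.floor_le (by positivity)
  have hnL : (⌊ε * r⌋₊ : ℝ) ≤ ε * r := Nat.floor_le (by positivity)
  obtain ⟨gR, hRm, hR0, hRb, hRi, hRe⟩ := hC T ((1 + ε) * r) hT (by positivity) _ hnR
  obtain ⟨gL, hLm, hL0, hLb, hLi, hLe⟩ := hC T (ε * r) hT (by positivity) _ hnL
  have hinjR : ∀ x : ℕ, Function.Injective fun i => x + i := fun x => add_right_injective x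
  have hinjL : ∀ x : ℕ, Function.Injective fun i => if i < x then x - 1 - i else i := by
    intro x i i' h
    simp only at h
    split_ifs at h <;> omega
  have hidR := fun x => (identDistrib_precomp hX.indep hX.ident (hinjR x)).comp hRm
  have hidL := fun x => (identDistrib_precomp hX.indep hX.ident (hinjL x)).comp hLm
  have hiR := fun x => (hidR x).integrable_iff.2 hRi
  have hiL := fun x => (hidL x).integrable_iff.2 hLi
  refine ⟨fun x ω => (1 + κ) * gR (fun i => X (x + i) ω) +
    (1 + 1 / κ) * gL (fun i => X (if i < x then x - 1 - i else i) ω), fun x ω => ?_, fun x => ?_,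
    fun x => ?_, fun a x b hax hxb hxa hbx ω => ?_⟩
  · have := hR0 fun i => X (x + i) ω
    have := hL0 fun i => X (if i < x then x - 1 - i else i) ω
    positivity
  · exact ((hiR x).const_mul _).add ((hiL x).const_mul _)
  · have h1 := integral_add ((hiR x).const_mul (1 + κ)) ((hiL x).const_mul (1 + 1 / κ))
    rw [integral_const_mul, integral_const_mul, (hidR x).integral_eq, (hidL x).integral_eq] at h1
    refine (h1.trans_le ?_ : _)
    set E := Real.exp (-((1 + κ / 2) * T)) with hE
    have hE0 : 0 ≤ E := (Real.exp_pos _).le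
    set R := √(T / r) ^ δ with hRdef
    have hRnn : 0 ≤ R := by positivity
    have b1 : √(T / ((1 + ε) * r)) ^ δ ≤ R := by
      refine Real.rpow_le_rpow (Real.sqrt_nonneg _) (Real.sqrt_le_sqrt ?_) hδ.le
      gcongr
      nlinarith
    have b2 : √(T / (ε * r)) ^ δ = B * R := by
      rw [hB, hRdef, ← Real.mul_rpow (Real.sqrt_nonneg _) (Real.sqrt_nonneg _),
        ← Real.sqrt_mul (by positivity)]
      congr 2
      field_simp
    rw [b2] at hLe
    have c1 : ∫ ω, gR (fun i => X i ω) ∂μ ≤ C * (2 * r) * (E + R) := by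
      refine hRe.trans ?_
      gcongr
      linarith
    have c2 : ∫ ω, gL (fun i => X i ω) ∂μ ≤ C * r * (B * (E + R)) := by
      refine hLe.trans ?_
      have : E + B * R ≤ B * (E + R) := by nlinarith
      refine mul_le_mul ?_ this (by positivity) (by positivity)
      refine mul_le_mul_of_nonneg_left ?_ hC0
      nlinarith
    calc _ ≤ (1 + κ) * (C * (2 * r) * (E + R)) + (1 + 1 / κ) * (C * r * (B * (E + R))) :=
          add_le_add (mul_le_mul_of_nonneg_left c1 (by positivity))
            (mul_le_mul_of_nonneg_left c2 (by positivity))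
      _ = _ := by ring
  · have hR := hRb (fun i => X (x + i) ω) (b - x) (Nat.le_floor (by rwa [hr, ← pow_succ']))
    have hL := hLb (fun i => X (if i < x then x - 1 - i else i) ω) (x - a) (Nat.le_floor hxa)
    rw [← sum_Ico_eq_sum_range_reflect (fun i => X i ω)] at hL
    rw [← Finset.sum_Ico_eq_sum_range (fun i => X i ω)] at hR
    rw [← Finset.sum_Ico_consecutive _ hax hxb, add_comm]
    refine (add_sq_le_of_pos hκ0).trans ?_
    have d1 := mul_le_mul_of_nonneg_left hR (show 0 ≤ 1 + κ by positivity)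
    have d2 := mul_le_mul_of_nonneg_left hL (show 0 ≤ 1 + 1 / κ by positivity)
    have d3 : (1 + κ) * ((1 + κ) * (2 * (1 + 2 * κ)) * T * ((1 + ε) * r)) +
        (1 + 1 / κ) * ((1 + κ) * (2 * (1 + 2 * κ)) * T * (ε * r)) =
        2 * ((1 + κ) ^ 2 * (1 + 2 * κ) * (1 + κ + κ ^ 2)) * (T * r) := by
      rw [hε]
      field_simp
      ring
    have d4 : 2 * ((1 + κ) ^ 2 * (1 + 2 * κ) * (1 + κ + κ ^ 2)) ≤ c := by
      have p3 := quintic_le hκ0.le hκ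
      linarith
    have d5 := mul_le_mul_of_nonneg_right d4 (show 0 ≤ T * r by positivity)
    linarith

/-- The squares of the sums over disjoint intervals exceed the level `c T` times the length, where
`c > 2`, only by a total error of small expectation, uniformly over all packings. -/
theorem IsStandardIID.exists_packing_bound (hX : IsStandardIID μ X δ) (hδ : 0 < δ) {c : ℝ}
    (hc : 2 < c) :
    ∃ κ C : ℝ, 0 < κ ∧ 0 ≤ C ∧ ∀ T : ℝ, 1 ≤ T → ∀ N : ℕ, 1 ≤ N →
      ∃ Z : Ω → ℝ, (∀ ω, 0 ≤ Z ω) ∧ Integrable Z μ ∧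
        ∫ ω, Z ω ∂μ ≤
          C * N * ((Real.log N + 1) * Real.exp (-((1 + κ) * T)) + √T ^ δ) ∧
        ∀ ω F, IsPacking 0 N F →
          ∑ I ∈ F, max ((∑ i ∈ I, X i ω) ^ 2 - c * T * I.card) 0 ≤ Z ω := by
  classical
  obtain ⟨κ, ε, C, hκ0, hε0, hε1, hC0, hC⟩ := hX.exists_scale_bound hδ hc
  set ρ := 1 + ε with hρ
  have hρ1 : 1 < ρ := by linarith
  have hρ0 : 0 < ρ := by linarith
  have hlog : 0 < Real.log ρ := Real.log_pos hρ1
  set q := (1 / √ρ) ^ δ with hq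
  have hq0 : 0 ≤ q := by positivity
  have hq1 : q < 1 := by
    refine Real.rpow_lt_one (by positivity) ?_ hδ
    rw [div_lt_one (by positivity)]
    exact Real.lt_sqrt_of_sq_lt (by simpa using hρ1)
  have hq1' : 0 < 1 - q := by linarith
  refine ⟨κ, 2 * C / ε * ((1 / Real.log ρ + 1) + 1 / (1 - q)), hκ0, by positivity,
    fun T hT N hN => ?_⟩
  have hN' : (1 : ℝ) ≤ N := by exact_mod_cast hN
  have hlogN : 0 ≤ Real.log N := Real.log_nonneg hN'
  choose y hy0 hyi hye hyb using hC T hT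
  set h : ℕ → ℕ := fun j => ⌊ε * ρ ^ j⌋₊ + 1 with hh
  set J : ℕ := ⌊Real.log N / Real.log ρ⌋₊ + 1 with hJ
  have hJmem : ∀ j, j < J ↔ ρ ^ j ≤ N := by
    intro j
    rw [hJ, Nat.lt_succ_iff, Nat.le_floor_iff (by positivity), le_div_iff₀ hlog,
      ← Real.log_pow, Real.log_le_log_iff (by positivity) (by positivity)]
  refine ⟨fun ω => ∑ p ∈ (Finset.range J).sigma fun j => Finset.range (N / h j + 1),
    y p.1 (p.2 * h p.1) ω, fun ω => Finset.sum_nonneg fun p _ => hy0 _ _ _,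
    integrable_finsetSum _ fun p _ => hyi _ _, ?_, ?_⟩
  · rw [integral_finsetSum _ fun p _ => hyi _ _, Finset.sum_sigma]
    set E := Real.exp (-((1 + κ) * T)) with hE
    have hE0 : 0 ≤ E := (Real.exp_pos _).le
    have hterm : ∀ j ∈ Finset.range J, ∑ m ∈ Finset.range (N / h j + 1),
        ∫ ω, y j (m * h j) ω ∂μ ≤ 2 * C / ε * N * (E + √T ^ δ * q ^ j) := by
      intro j hj
      have hρj := (hJmem j).1 (Finset.mem_range.1 hj)
      have hρj0 : 0 < ρ ^ j := by positivity
      have e1 : √(T / ρ ^ j) ^ δ = √T ^ δ * q ^ j := by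
        have : √(T / ρ ^ j) = √T * (1 / √ρ) ^ j := by
          rw [Real.sqrt_div (by linarith), div_pow, one_pow, mul_one_div]
          congr 1
          rw [Real.sqrt_eq_iff_mul_self_eq (by positivity) (by positivity), ← mul_pow,
            Real.mul_self_sqrt hρ0.le]
        rw [this, Real.mul_rpow (by positivity) (by positivity), hq,
          ← Real.rpow_natCast, ← Real.rpow_natCast, ← Real.rpow_mul (by positivity),
          ← Real.rpow_mul (by positivity), mul_comm (j : ℝ)]
      refine (Finset.sum_le_sum fun m _ => hye j (m * h j)).trans ?_
      rw [Finset.sum_const, Finset.card_range, nsmul_eq_mul, e1]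
      have e2 : ((N / h j + 1 : ℕ) : ℝ) ≤ 2 * N / (ε * ρ ^ j) := by
        have h1 : ((N / h j : ℕ) : ℝ) ≤ N / (ε * ρ ^ j) := by
          refine Nat.cast_div_le.trans ?_
          refine div_le_div_of_nonneg_left (by positivity) (by positivity) ?_
          simp only [hh]
          push_cast
          exact (Nat.lt_floor_add_one _).le
        have h2 : (1 : ℝ) ≤ N / (ε * ρ ^ j) := by
          rw [le_div_iff₀ (by positivity)]
          nlinarith
        push_cast
        rw [mul_div_assoc]
        linarith
      refine (mul_le_mul_of_nonneg_right e2 (by positivity)).trans (le_of_eq ?_)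
      field_simp
    refine (Finset.sum_le_sum hterm).trans ?_
    rw [← Finset.mul_sum, Finset.sum_add_distrib, ← Finset.mul_sum, Finset.sum_const,
      Finset.card_range, nsmul_eq_mul]
    have g1 : ∑ j ∈ Finset.range J, q ^ j ≤ 1 / (1 - q) := by
      rw [one_div, ← tsum_geometric_of_lt_one hq0 hq1]
      exact (summable_geometric_of_lt_one hq0 hq1).sum_le_tsum _ fun _ _ => by positivity
    have g2 : (J : ℝ) ≤ (1 / Real.log ρ + 1) * (Real.log N + 1) := by
      have : (⌊Real.log N / Real.log ρ⌋₊ : ℝ) ≤ Real.log N / Real.log ρ :=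
        Nat.floor_le (by positivity)
      rw [hJ]
      push_cast
      have e : (1 / Real.log ρ + 1) * (Real.log N + 1) =
        Real.log N / Real.log ρ + 1 / Real.log ρ + Real.log N + 1 := by ring
      rw [e]
      have : 0 ≤ 1 / Real.log ρ := by positivity
      linarith
    have g3 : 0 ≤ 1 / Real.log ρ + 1 := by positivity
    have g4 : 0 ≤ 1 / (1 - q) := by positivity
    set L := Real.log N + 1 with hL
    have hL0 : 0 ≤ L := by positivity
    have hT0 : 0 ≤ √T ^ δ := by positivity
    calc 2 * C / ε * N * (J * E + √T ^ δ * ∑ j ∈ Finset.range J, q ^ j)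
        ≤ 2 * C / ε * N * ((1 / Real.log ρ + 1) * L * E + √T ^ δ * (1 / (1 - q))) := by gcongr
      _ ≤ 2 * C / ε * N * (((1 / Real.log ρ + 1) + 1 / (1 - q)) * (L * E + √T ^ δ)) := by
          refine mul_le_mul_of_nonneg_left ?_ (by positivity)
          have t1 : 0 ≤ 1 / (1 - q) * (L * E) := by positivity
          have t2 : 0 ≤ (1 / Real.log ρ + 1) * √T ^ δ := by positivity
          linarith
      _ = _ := by ring
  · intro ω F hF
    have key : ∀ I ∈ F, ∃ p : (_ : ℕ) × ℕ,
        p ∈ ((Finset.range J).sigma fun j => Finset.range (N / h j + 1)) ∧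
        p.2 * h p.1 ∈ I ∧
        max ((∑ i ∈ I, X i ω) ^ 2 - c * T * I.card) 0 ≤ y p.1 (p.2 * h p.1) ω := by
      intro I hI
      obtain ⟨a, b, -, hab, hbN, rfl⟩ := hF.1 I hI
      have hn1 : (1 : ℝ) ≤ ((b - a : ℕ) : ℝ) := by
        have : 1 ≤ b - a := by omega
        exact_mod_cast this
      obtain ⟨j, hj1, hj2⟩ := exists_nat_pow_near hn1 hρ1
      have hρj0 : 1 ≤ ρ ^ j := one_le_pow₀ hρ1.le
      have hhj : h j ≤ b - a := by
        simp only [hh]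
        rcases lt_or_ge (ε * ρ ^ j) 1 with hlt | hge
        · rw [Nat.floor_eq_zero.2 hlt]
          omega
        · have h1 : (⌊ε * ρ ^ j⌋₊ : ℝ) ≤ ε * ρ ^ j := Nat.floor_le (by positivity)
          have : ((⌊ε * ρ ^ j⌋₊ + 1 : ℕ) : ℝ) ≤ ((b - a : ℕ) : ℝ) := by
            push_cast
            nlinarith
          exact_mod_cast this
      have hhpos : 0 < h j := Nat.succ_pos _
      set m := (a + (h j - 1)) / h j with hm
      have hm1 : m * h j ≤ a + (h j - 1) := Nat.div_mul_le_self _ _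
      have hm2 : a ≤ m * h j := by
        have := Nat.lt_div_mul_add (a := a + (h j - 1)) hhpos
        rw [← hm] at this
        omega
      have hmb : m * h j < b := by omega
      refine ⟨⟨j, m⟩, ?_, Finset.mem_Ico.2 ⟨hm2, hmb⟩, ?_⟩
      · simp only [Finset.mem_sigma, Finset.mem_range, Nat.lt_succ_iff]
        refine ⟨(hJmem j).2 (hj1.trans ?_), ?_⟩
        · exact_mod_cast (Nat.sub_le b a).trans hbN
        · rw [Nat.le_div_iff_mul_le hhpos]
          omega
      · refine max_le ?_ (hy0 _ _ _)
        have hx1 : ((m * h j - a : ℕ) : ℝ) ≤ ε * ρ ^ j := by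
          have h1 : m * h j - a ≤ ⌊ε * ρ ^ j⌋₊ := by
            have : h j = ⌊ε * ρ ^ j⌋₊ + 1 := rfl
            omega
          exact le_trans (by exact_mod_cast h1) (Nat.floor_le (by positivity))
        have hx2 : ((b - m * h j : ℕ) : ℝ) ≤ ρ ^ (j + 1) := by
          refine le_trans ?_ hj2.le
          exact_mod_cast Nat.sub_le_sub_left hm2 b
        have := hyb j a (m * h j) b hm2 hmb.le hx1 hx2 ω
        have h3 : c * T * ρ ^ j ≤ c * T * ((b - a : ℕ) : ℝ) :=
          mul_le_mul_of_nonneg_left hj1 (by nlinarith)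
        simp only [Nat.card_Ico]
        linarith
    choose! φ hφ1 hφ2 hφ3 using key
    have hinj : Set.InjOn φ (F : Set (Finset ℕ)) := by
      intro I hI I' hI' hII
      by_contra hne
      have hd : Disjoint I I' := hF.2 hI hI' hne
      exact Finset.disjoint_left.1 hd (hφ2 I hI) (by rw [hII]; exact hφ2 I' hI')
    calc _ ≤ ∑ I ∈ F, y (φ I).1 ((φ I).2 * h (φ I).1) ω := Finset.sum_le_sum hφ3
      _ = ∑ p ∈ F.image φ, y p.1 (p.2 * h p.1) ω :=
          (Finset.sum_image (f := fun p : (_ : ℕ) × ℕ => y p.1 (p.2 * h p.1) ω) hinj).symm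
      _ ≤ _ := Finset.sum_le_sum_of_subset_of_nonneg
          (Finset.image_subset_iff.2 hφ1) fun p _ _ => hy0 _ _ _
end

theorem ae_eventually_notMem_of_summable {Ω : Type*} [MeasurableSpace Ω] {μ : Measure Ω}
    [IsFiniteMeasure μ] {s : ℕ → Set Ω} {p : ℕ → ℝ} (hp : Summable p)
    (h : ∀ᶠ k in atTop, μ.real (s k) ≤ p k) : ∀ᵐ ω ∂μ, ∀ᶠ k in atTop, ω ∉ s k := by
  have hs : Summable fun k => μ.real (s k) :=
    Summable.of_norm_bounded_eventually_nat hp (h.mono fun k hk => by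
      rwa [Real.norm_of_nonneg measureReal_nonneg])
  refine ae_eventually_notMem (ne_of_eq_of_ne ?_ (ENNReal.ofReal_ne_top (r := ∑' k, μ.real (s k))))
  rw [ENNReal.ofReal_tsum_of_nonneg (fun k => measureReal_nonneg) hs]
  simp

theorem IsPacking.map_add {n : ℕ} {F : Finset (Finset ℕ)} (hF : IsPacking 0 n F) (z : ℕ) :
    IsPacking z (z + n) (F.map (Finset.mapEmbedding (addLeftEmbedding z)).toEmbedding) := by
  constructor
  · intro I hI
    obtain ⟨I', hI', rfl⟩ := Finset.mem_map.1 hI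
    obtain ⟨c, d, -, h2, h3, rfl⟩ := hF.1 I' hI'
    refine ⟨z + c, z + d, by omega, by omega, by omega, ?_⟩
    simp [Finset.mapEmbedding_apply]
  · intro I hI J hJ hIJ
    obtain ⟨I', hI', rfl⟩ := Finset.mem_map.1 (Finset.mem_coe.1 hI)
    obtain ⟨J', hJ', rfl⟩ := Finset.mem_map.1 (Finset.mem_coe.1 hJ)
    have : Disjoint I' J' := hF.2 hI' hJ' fun e => hIJ (by rw [e])
    simpa [Function.onFun, Finset.mapEmbedding_apply] using this

/-- The sequences for which, for some `0 < n ≤ M`, the excess over the level `θ` of the squared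
sums over some packing of `[0, n)` is larger than `A * n`. -/
def excessSet (θ A : ℝ) (M : ℕ) : Set (ℕ → ℝ) :=
  {x | ∃ n, 0 < n ∧ n ≤ M ∧ ∃ F, IsPacking 0 n F ∧
    A * n < ∑ I ∈ F, max ((∑ i ∈ I, x i) ^ 2 - θ * I.card) 0}

theorem measurableSet_excessSet (θ A : ℝ) (M : ℕ) : MeasurableSet (excessSet θ A M) := by
  simp only [excessSet, Set.ofPred_exists, Set.ofPred_and]
  refine MeasurableSet.iUnion fun n => (MeasurableSet.const _).inter ((MeasurableSet.const _).inter
    (MeasurableSet.iUnion fun F => (MeasurableSet.const _).inter ?_))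
  exact measurableSet_lt (by fun_prop) (by fun_prop)

section
variable {Ω : Type*} [MeasurableSpace Ω] {μ : Measure Ω} [IsProbabilityMeasure μ]
  {X : ℕ → Ω → ℝ} {δ : ℝ}

/-- A maximal inequality of ergodic type. -/
theorem IsStandardIID.mul_measureReal_excessSet_le (hX : IsStandardIID μ X δ) {θ A : ℝ}
    (hA : 0 ≤ A) (M : ℕ) {Z : Ω → ℝ} (hZ : Integrable Z μ)
    (hZF : ∀ ω F, IsPacking 0 (2 * M) F →
      ∑ I ∈ F, max ((∑ i ∈ I, X i ω) ^ 2 - θ * I.card) 0 ≤ Z ω) :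
    A * M * μ.real {ω | (fun i => X i ω) ∈ excessSet θ A M} ≤ ∫ ω, Z ω ∂μ := by
  classical
  have hE := measurableSet_excessSet θ A M
  have hmeas : ∀ z : ℕ, MeasurableSet {ω | (fun i => X (z + i) ω) ∈ excessSet θ A M} := fun z =>
    (measurable_pi_lambda (fun ω i => X (z + i) ω) fun i => hX.meas _) hE
  have hlaw : ∀ z : ℕ, μ.real {ω | (fun i => X (z + i) ω) ∈ excessSet θ A M} =
      μ.real {ω | (fun i => X i ω) ∈ excessSet θ A M} := fun z =>
    congrArg ENNReal.toReal
      ((identDistrib_precomp hX.indep hX.ident (add_right_injective z)).measure_mem_eq hE)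
  have hle : ∀ ω, ∑ z ∈ Finset.range M,
      A * ({ω | (fun i => X (z + i) ω) ∈ excessSet θ A M}.indicator (fun _ => (1 : ℝ)) ω) ≤ Z ω := by
    intro ω
    obtain ⟨F, hF, hFA⟩ := exists_isPacking_card_mul_le (N := 2 * M) hA
      (fun I => max ((∑ i ∈ I, X i ω) ^ 2 - θ * I.card) 0)
      ((Finset.range M).filter fun z => (fun i => X (z + i) ω) ∈ excessSet θ A M) (by
        intro z hz
        simp only [Finset.mem_filter, Finset.mem_range] at hz
        obtain ⟨hzM, n, hn0, hnM, F, hF, hlt⟩ := hz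
        refine ⟨n, hn0, by omega, _, hF.map_add z, ?_⟩
        rw [Finset.sum_map]
        refine hlt.le.trans (le_of_eq (Finset.sum_congr rfl fun I _ => ?_))
        simp [Finset.mapEmbedding_apply])
    refine le_trans (le_of_eq ?_) (hFA.trans (hZF ω F hF))
    rw [← Finset.mul_sum, Finset.card_filter]
    push_cast
    congr 1
  have hi : ∀ z : ℕ, Integrable (fun ω =>
      A * ({ω | (fun i => X (z + i) ω) ∈ excessSet θ A M}.indicator (fun _ => (1 : ℝ)) ω)) μ :=
    fun z => ((integrable_const 1).indicator (hmeas z)).const_mul A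
  have := integral_mono (integrable_finsetSum _ fun z _ => hi z) hZ hle
  rw [integral_finsetSum _ fun z _ => hi z] at this
  refine le_trans (le_of_eq ?_) this
  have h1 : ∀ z ∈ Finset.range M, ∫ ω,
      A * ({ω | (fun i => X (z + i) ω) ∈ excessSet θ A M}.indicator (fun _ => (1 : ℝ)) ω) ∂μ =
      A * μ.real {ω | (fun i => X i ω) ∈ excessSet θ A M} := by
    intro z _
    rw [integral_const_mul, integral_indicator_const _ (hmeas z), hlaw z]
    simp
  rw [Finset.sum_congr rfl h1]
  simp
  ring

theorem tendsto_log_log_natCast : Tendsto (fun N : ℕ => Real.log (Real.log N)) atTop atTop :=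
  Real.tendsto_log_atTop.comp (Real.tendsto_log_atTop.comp tendsto_natCast_atTop_atTop)

theorem IsStandardIID.eventually_squareVariation_le (hX : IsStandardIID μ X δ) (hδ : 0 < δ)
    (hδ1 : δ ≤ 1) {c : ℝ} (hc : 2 < c) :
    ∀ᵐ ω ∂μ, ∀ᶠ N : ℕ in atTop,
      squareVariation (fun i => X i ω) N ≤ c * N * Real.log (Real.log N) := by
  set b := 1 + c / 2 with hb
  set a := c / 2 - 1 with ha
  have ha0 : 0 < a := by rw [ha]; linarith
  obtain ⟨κ, C, hκ0, hC0, hC⟩ := hX.exists_packing_bound hδ (c := b) (by rw [hb]; linarith)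
  set T : ℕ → ℝ := fun k => (1 + κ) ^ k with hT
  set M : ℕ → ℕ := fun k => ⌈Real.exp (Real.exp (T (k + 1)))⌉₊ with hM
  have hT1 : ∀ k, 1 ≤ T k := fun k => one_le_pow₀ (by linarith)
  have hprob : ∀ k, μ.real {ω | (fun i => X i ω) ∈ excessSet (b * T k) (a * T k) (M k)} ≤
      10 * C / a * (1 / √(1 + κ)) ^ k := by
    intro k
    have hTk := hT1 k
    have hM1 : 1 ≤ M k := Nat.one_le_ceil_iff.2 (Real.exp_pos _)
    have hM1' : (1 : ℝ) ≤ M k := by exact_mod_cast hM1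
    obtain ⟨Z, -, hZi, hZe, hZF⟩ := hC (T k) hTk (2 * M k) (by omega)
    have h1 := hX.mul_measureReal_excessSet_le (A := a * T k) (by positivity) (M k) hZi hZF
    have h2 := h1.trans hZe
    set E := Real.exp (T (k + 1)) with hE
    have hE1 : 1 ≤ E := Real.one_le_exp (by linarith [hT1 (k + 1)])
    have hlog : Real.log ((2 * M k : ℕ) : ℝ) + 1 ≤ 4 * E := by
      have g1 : ((2 * M k : ℕ) : ℝ) ≤ 4 * Real.exp E := by
        have := (Nat.ceil_lt_add_one (Real.exp_pos E).le).le
        have h' := Real.one_le_exp (show 0 ≤ E by linarith)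
        push_cast
        change (M k : ℝ) ≤ Real.exp E + 1 at this
        linarith
      have g2 := Real.log_le_log (by push_cast; positivity) g1
      rw [Real.log_mul (by norm_num) (Real.exp_pos _).ne', Real.log_exp] at g2
      have g3 : Real.log 4 ≤ 2 := by
        have : (4 : ℝ) = 2 ^ 2 := by norm_num
        rw [this, Real.log_pow]
        have := Real.log_two_lt_d9
        push_cast
        linarith
      linarith
    have hEE : E * Real.exp (-((1 + κ) * T k)) = 1 := by
      rw [hE, ← Real.exp_add]
      simp only [hT, pow_succ']
      simp
    have h3 : (Real.log ((2 * M k : ℕ) : ℝ) + 1) * Real.exp (-((1 + κ) * T k)) ≤ 4 := by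
      refine (mul_le_mul_of_nonneg_right hlog (Real.exp_pos _).le).trans (le_of_eq ?_)
      rw [mul_assoc, hEE, mul_one]
    have hs1 : 1 ≤ √(T k) := Real.one_le_sqrt.2 hTk
    have h4 : √(T k) ^ δ ≤ √(T k) := by
      simpa using Real.rpow_le_rpow_of_exponent_le hs1 hδ1
    set P := μ.real {ω | (fun i => X i ω) ∈ excessSet (b * T k) (a * T k) (M k)} with hP
    have h5 : a * T k * M k * P ≤ C * (2 * M k) * (5 * √(T k)) := by
      refine h2.trans ?_
      push_cast at h3 ⊢
      refine mul_le_mul_of_nonneg_left ?_ (by positivity)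
      linarith
    have h6 : a * √(T k) * P ≤ 10 * C := by
      have hpos : 0 < (M k : ℝ) * √(T k) := by positivity
      refine le_of_mul_le_mul_left (le_trans (le_of_eq ?_) (h5.trans (le_of_eq ?_))) hpos
      · have : T k = √(T k) * √(T k) := (Real.mul_self_sqrt (by linarith)).symm
        calc _ = a * (√(T k) * √(T k)) * M k * P := by ring
          _ = _ := by rw [← this]
      · ring
    have h7 : (1 / √(1 + κ)) ^ k = 1 / √(T k) := by
      rw [div_pow, one_pow]
      congr 1
      rw [eq_comm, Real.sqrt_eq_iff_mul_self_eq (by positivity) (by positivity), ← mul_pow,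
        Real.mul_self_sqrt (by positivity)]
    rw [h7, div_mul_div_comm, mul_one, le_div_iff₀ (by positivity)]
    linarith
  have hsum : Summable fun k : ℕ => 10 * C / a * (1 / √(1 + κ)) ^ k := by
    refine (summable_geometric_of_lt_one (by positivity) ?_).mul_left _
    rw [div_lt_one (by positivity)]
    exact Real.lt_sqrt_of_sq_lt (by linarith)
  filter_upwards [ae_eventually_notMem_of_summable hsum (Eventually.of_forall hprob)] with ω hω
  obtain ⟨k₀, hk₀⟩ := eventually_atTop.1 hω
  filter_upwards [tendsto_log_log_natCast.eventually_ge_atTop (T k₀), eventually_ge_atTop 2]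
    with N hN hN2
  set ℓ := Real.log (Real.log N) with hℓ
  obtain ⟨k, hk1, hk2⟩ := exists_nat_pow_near ((hT1 k₀).trans hN) (show 1 < 1 + κ by linarith)
  have hkk : k₀ ≤ k := by
    by_contra hlt
    have : T (k + 1) ≤ T k₀ := pow_le_pow_right₀ (by linarith) (by omega)
    exact absurd (hk2.trans_le (this.trans hN)) (lt_irrefl _)
  have hN2' : (2 : ℝ) ≤ N := by exact_mod_cast hN2
  have hlogN : 0 < Real.log N := Real.log_pos (by linarith)
  have hNM : N ≤ M k := by
    have h1 : Real.log N < Real.exp (T (k + 1)) := (Real.log_lt_iff_lt_exp hlogN).1 hk2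
    have h2 : (N : ℝ) < Real.exp (Real.exp (T (k + 1))) :=
      (Real.log_lt_iff_lt_exp (by linarith)).1 h1
    exact_mod_cast h2.le.trans (Nat.le_ceil _)
  have hnot := hk₀ k hkk
  simp only [excessSet, Set.mem_ofPred_eq, not_exists, not_and, not_lt] at hnot
  refine squareVariation_le fun F hF => ?_
  have h1 := hnot N (by omega) hNM F hF
  have h2 : ∑ I ∈ F, |∑ i ∈ I, X i ω| ^ 2 ≤ ∑ I ∈ F, (b * T k * I.card +
      max ((∑ i ∈ I, X i ω) ^ 2 - b * T k * I.card) 0) := by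
    refine Finset.sum_le_sum fun I _ => ?_
    rw [sq_abs]
    linarith [le_max_left ((∑ i ∈ I, X i ω) ^ 2 - b * T k * I.card) 0]
  rw [Finset.sum_add_distrib, ← Finset.mul_sum] at h2
  have h3 : ∑ I ∈ F, (I.card : ℝ) ≤ N := by
    have := hF.sum_card_le
    rw [Nat.sub_zero] at this
    exact_mod_cast this
  have h4 : b * T k * ∑ I ∈ F, (I.card : ℝ) ≤ b * T k * N :=
    mul_le_mul_of_nonneg_left h3 (by have := hT1 k; positivity)
  have h5 : b * T k * N + a * T k * N = c * N * T k := by rw [hb, ha]; ring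
  have h6 : c * N * T k ≤ c * N * ℓ := mul_le_mul_of_nonneg_left hk1 (by positivity)
  linarith
end

theorem exists_exp_lt_gaussianReal_Ioi {ε : ℝ} (hε : 0 < ε) :
    ∃ c : ℝ, 1 ≤ c ∧
      ENNReal.ofReal (Real.exp (-((1 + ε) * c ^ 2 / 2))) < gaussianReal 0 1 (Set.Ioi c) := by
  set c := 6 / ε + 1 with hc
  have hc1 : 1 ≤ c := by rw [hc]; linarith [show 0 < 6 / ε by positivity]
  have hεc : 6 < ε * c := by rw [hc, mul_add, mul_div_cancel₀ _ hε.ne']; linarith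
  refine ⟨c, hc1, ?_⟩
  set d := (√(2 * Real.pi))⁻¹ * Real.exp (-(c + 1) ^ 2 / 2) with hd
  have h1 : Real.exp (-((1 + ε) * c ^ 2 / 2)) < d := by
    have h2 : Real.exp (-1) ≤ (√(2 * Real.pi))⁻¹ := by
      rw [Real.exp_neg]
      refine inv_anti₀ (by positivity) (Real.sqrt_le_iff.2 ⟨(Real.exp_pos _).le, ?_⟩)
      have := Real.exp_one_gt_d9
      have := Real.pi_lt_d2
      nlinarith
    refine lt_of_lt_of_le ?_ (mul_le_mul_of_nonneg_right h2 (Real.exp_pos _).le)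
    rw [← Real.exp_add]
    refine Real.exp_lt_exp.2 ?_
    nlinarith
  calc _ < ENNReal.ofReal d := (ENNReal.ofReal_lt_ofReal_iff (by positivity)).2 h1
    _ = ∫⁻ x in Set.Ioc c (c + 1), ENNReal.ofReal d := by simp
    _ ≤ ∫⁻ x in Set.Ioc c (c + 1), gaussianPDF 0 1 x := by
        refine setLIntegral_mono' measurableSet_Ioc fun x hx => ?_
        refine ENNReal.ofReal_le_ofReal ?_
        simp only [gaussianPDFReal_def, hd, NNReal.coe_one, mul_one, sub_zero]
        refine mul_le_mul_of_nonneg_left (Real.exp_le_exp.2 ?_) (by positivity)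
        have h0 : 0 ≤ x := by linarith [hx.1]
        have : x ^ 2 ≤ (c + 1) ^ 2 := pow_le_pow_left₀ h0 hx.2 2
        linarith
    _ = gaussianReal 0 1 (Set.Ioc c (c + 1)) := (gaussianReal_apply _ one_ne_zero _).symm
    _ ≤ _ := measure_mono fun x hx => hx.1

theorem measureReal_inter_eq_mul {Ω : Type*} [MeasurableSpace Ω] {μ : Measure Ω}
    {X : ℕ → Ω → ℝ} (hX : iIndepFun X μ) (hm : ∀ i, Measurable (X i))
    {S T : Finset ℕ} (hST : Disjoint S T) {U V : Set (ℕ → ℝ)} (hU : MeasurableSet U)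
    (hV : MeasurableSet V) (hUS : DependsOn (· ∈ U) (S : Set ℕ))
    (hVT : DependsOn (· ∈ V) (T : Set ℕ)) :
    μ.real {ω | (fun i => X i ω) ∈ U ∩ V} =
      μ.real {ω | (fun i => X i ω) ∈ U} * μ.real {ω | (fun i => X i ω) ∈ V} := by
  have h := indepFun_comp_of_dependsOn hX hm hST (measurable_mem.2 hU)
    (measurable_mem.2 hV) hUS hVT
  have h1 := h.measure_inter_preimage_eq_mul {True} {True} (by measurability) (by measurability)
  have h2 := congrArg ENNReal.toReal h1
  rw [ENNReal.toReal_mul] at h2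
  have e : ∀ W : Set (ℕ → ℝ), (fun ω => (fun i => X i ω) ∈ W) ⁻¹' {True} =
      {ω | (fun i => X i ω) ∈ W} := fun W => by
    ext ω
    simp only [Set.mem_preimage, Set.mem_singleton_iff, eq_iff_iff, iff_true, Set.mem_ofPred_eq]
  rw [e, e] at h2
  exact h2

section
variable {Ω : Type*} [MeasurableSpace Ω] {μ : Measure Ω} [IsProbabilityMeasure μ]
  {X : ℕ → Ω → ℝ} {δ : ℝ}

theorem IsStandardIID.exists_exp_le_measureReal (hX : IsStandardIID μ X δ) {ε : ℝ} (hε : 0 < ε) :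
    ∃ c : ℝ, 1 ≤ c ∧ ∃ b₀ : ℕ, ∀ b ≥ b₀, Real.exp (-((1 + ε) * c ^ 2 / 2)) ≤
      μ.real {ω | c * √b ≤ ∑ i ∈ Finset.range b, X i ω} := by
  obtain ⟨c, hc1, hc⟩ := exists_exp_lt_gaussianReal_Ioi hε
  refine ⟨c, hc1, ?_⟩
  have hlim := tendstoInDistribution_inv_sqrt_mul_sum (P := μ) (X := X) (P' := gaussianReal 0 1)
    (Y := id) ⟨aemeasurable_id, Measure.map_id⟩ hX.mean (by simpa using hX.sq) hX.indep hX.ident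
  have h1 := ProbabilityMeasure.le_liminf_measure_open_of_tendsto hlim.tendsto (isOpen_Ioi (a := c))
  simp only [ProbabilityMeasure.coe_mk, Measure.map_id] at h1
  have h2 := eventually_lt_of_lt_liminf (hc.trans_le h1)
  obtain ⟨b₀, hb₀⟩ := eventually_atTop.1 h2
  refine ⟨b₀ + 1, fun b hb => ?_⟩
  have h3 := hb₀ b (by omega)
  rw [Measure.map_apply_of_aemeasurable (hlim.forall_aemeasurable b) measurableSet_Ioi] at h3
  rw [Measure.real, ← ENNReal.ofReal_le_iff_le_toReal (measure_ne_top _ _)]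
  refine h3.le.trans (measure_mono fun ω hω => ?_)
  have hb0 : 0 < √(b : ℝ) := Real.sqrt_pos.2 (by exact_mod_cast (show 0 < b by omega))
  have hω' : c < (√(b : ℝ))⁻¹ * ∑ i ∈ Finset.range b, X i ω := hω
  rw [inv_mul_eq_div, lt_div_iff₀ hb0] at hω'
  exact hω'.le

/-- The sequences for which each of the `k` consecutive blocks of length `b` starting at `s` has a
sum of at least `c √b`. -/
def blockSet (c : ℝ) (s b k : ℕ) : Set (ℕ → ℝ) :=
  {x | ∀ i < k, c * √b ≤ ∑ l ∈ Finset.Ico (s + i * b) (s + (i + 1) * b), x l}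

theorem blockSet_succ (c : ℝ) (s b k : ℕ) : blockSet c s b (k + 1) = blockSet c s b k ∩
    {x | c * √b ≤ ∑ l ∈ Finset.Ico (s + k * b) (s + (k + 1) * b), x l} := by
  ext x
  exact Nat.forall_lt_succ_right

theorem measurableSet_blockSet (c : ℝ) (s b k : ℕ) : MeasurableSet (blockSet c s b k) := by
  induction k with
  | zero => simp [blockSet]
  | succ k ih =>
    rw [blockSet_succ]
    exact ih.inter (measurableSet_le (by fun_prop) (by fun_prop))

theorem dependsOn_blockSet (c : ℝ) (s b k : ℕ) :
    DependsOn (· ∈ blockSet c s b k) ((Finset.Ico s (s + k * b) : Finset ℕ) : Set ℕ) := by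
  intro x y hxy
  simp only [blockSet, Set.mem_ofPred_eq, eq_iff_iff]
  refine forall₂_congr fun i hi => ?_
  rw [Finset.sum_congr rfl fun l hl => hxy l ?_]
  have h1 : (i + 1) * b ≤ k * b := Nat.mul_le_mul_right b hi
  simp only [Finset.mem_Ico, Finset.coe_Ico, Set.mem_Ico] at hl ⊢
  omega

theorem IsStandardIID.pow_le_measureReal_blockSet (hX : IsStandardIID μ X δ) {c q : ℝ} (hq : 0 ≤ q)
    {b : ℕ} (h : q ≤ μ.real {ω | c * √b ≤ ∑ i ∈ Finset.range b, X i ω}) (s k : ℕ) :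
    q ^ k ≤ μ.real {ω | (fun i => X i ω) ∈ blockSet c s b k} := by
  induction k with
  | zero => simp [blockSet]
  | succ k ih =>
    set V : Set (ℕ → ℝ) := {x | c * √b ≤ ∑ l ∈ Finset.Ico (s + k * b) (s + (k + 1) * b), x l}
      with hV
    have hVm : MeasurableSet V := measurableSet_le (by fun_prop) (by fun_prop)
    have h1 : s + (k + 1) * b - (s + k * b) = b := by rw [add_mul, one_mul]; omega
    have hV1 : μ.real {ω | (fun i => X i ω) ∈ V} =
        μ.real {ω | c * √b ≤ ∑ i ∈ Finset.range b, X i ω} := by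
      have h2 : MeasurableSet {x : ℕ → ℝ | c * √b ≤ ∑ i ∈ Finset.range b, x i} :=
        measurableSet_le (by fun_prop) (by fun_prop)
      have h3 := congrArg ENNReal.toReal ((identDistrib_precomp hX.indep hX.ident
        (add_right_injective (s + k * b))).measure_mem_eq h2)
      refine Eq.trans ?_ h3
      simp only [hV, Set.mem_ofPred_eq, Finset.sum_Ico_eq_sum_range, h1]
      rfl
    have hVd : DependsOn (· ∈ V)
        ((Finset.Ico (s + k * b) (s + (k + 1) * b) : Finset ℕ) : Set ℕ) := by
      intro x y hxy
      simp only [hV, Set.mem_ofPred_eq]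
      rw [Finset.sum_congr rfl fun l hl => hxy l (Finset.mem_coe.2 hl)]
    rw [blockSet_succ, measureReal_inter_eq_mul hX.indep hX.meas
      (Finset.Ico_disjoint_Ico_consecutive s _ _) (measurableSet_blockSet c s b k) hVm
      (dependsOn_blockSet c s b k) hVd, hV1, pow_succ]
    exact mul_le_mul ih h hq measureReal_nonneg

/-- The sequences for which none of the intervals `[k r ^ j, k r ^ (j + 1))`, `j₀ ≤ j < J`,
consists of `k` blocks with large sums. -/
def noBlockSet (c : ℝ) (r k j₀ J : ℕ) : Set (ℕ → ℝ) :=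
  {x | ∀ j < J, j₀ ≤ j → x ∉ blockSet c (k * r ^ j) ((r - 1) * r ^ j) k}

theorem measurableSet_noBlockSet (c : ℝ) (r k j₀ J : ℕ) :
    MeasurableSet (noBlockSet c r k j₀ J) := by
  simp only [noBlockSet, Set.ofPred_forall]
  exact MeasurableSet.iInter fun j => MeasurableSet.iInter fun _ => MeasurableSet.iInter fun _ =>
    (measurableSet_blockSet _ _ _ _).compl

theorem mul_pow_add_eq {r : ℕ} (hr : 1 ≤ r) (k j : ℕ) :
    k * r ^ j + k * ((r - 1) * r ^ j) = k * r ^ (j + 1) := by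
  obtain ⟨r, rfl⟩ := Nat.exists_eq_add_of_le' hr
  simp only [Nat.add_sub_cancel]
  ring

theorem IsStandardIID.measureReal_noBlockSet_le (hX : IsStandardIID μ X δ) {c q : ℝ} (hq : 0 ≤ q)
    (hq1 : q ≤ 1) {b₀ : ℕ} (h : ∀ b ≥ b₀, q ≤ μ.real {ω | c * √b ≤ ∑ i ∈ Finset.range b, X i ω})
    {r : ℕ} (hr : 2 ≤ r) (k n : ℕ) :
    μ.real {ω | (fun i => X i ω) ∈ noBlockSet c r k b₀ (b₀ + n)} ≤ (1 - q ^ k) ^ n := by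
  have hqk : q ^ k ≤ 1 := pow_le_one₀ hq hq1
  induction n with
  | zero => simp
  | succ n ih =>
    set V := (blockSet c (k * r ^ (b₀ + n)) ((r - 1) * r ^ (b₀ + n)) k)ᶜ with hV
    have e : noBlockSet c r k b₀ (b₀ + (n + 1)) = noBlockSet c r k b₀ (b₀ + n) ∩ V := by
      ext x
      simp only [noBlockSet, Set.mem_ofPred_eq, Set.mem_inter_iff, hV, Set.mem_compl_iff]
      rw [← add_assoc, Nat.forall_lt_succ_right]
      simp
    have hVm : MeasurableSet V := (measurableSet_blockSet _ _ _ _).compl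
    have hVd : DependsOn (· ∈ V)
        ((Finset.Ico (k * r ^ (b₀ + n)) (k * r ^ (b₀ + n + 1)) : Finset ℕ) : Set ℕ) := by
      intro x y hxy
      have := dependsOn_blockSet c (k * r ^ (b₀ + n)) ((r - 1) * r ^ (b₀ + n)) k (x := x) (y := y)
        (by rwa [mul_pow_add_eq (by omega)])
      simp only [hV, Set.mem_compl_iff]
      exact congrArg Not this
    have hUd : DependsOn (· ∈ noBlockSet c r k b₀ (b₀ + n))
        ((Finset.range (k * r ^ (b₀ + n)) : Finset ℕ) : Set ℕ) := by
      intro x y hxy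
      simp only [noBlockSet, Set.mem_ofPred_eq, eq_iff_iff]
      refine forall_congr' fun j => forall_congr' fun hj => forall_congr' fun _ => not_congr ?_
      have := dependsOn_blockSet c (k * r ^ j) ((r - 1) * r ^ j) k (x := x) (y := y) fun i hi => by
        refine hxy i ?_
        have h1 : k * r ^ (j + 1) ≤ k * r ^ (b₀ + n) :=
          Nat.mul_le_mul_left k (Nat.pow_le_pow_right (by omega) hj)
        rw [mul_pow_add_eq (by omega)] at hi
        simp only [Finset.coe_Ico, Set.mem_Ico, Finset.coe_range, Set.mem_Iio] at hi ⊢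
        omega
      exact iff_of_eq this
    have hb : b₀ ≤ (r - 1) * r ^ (b₀ + n) := by
      have h1 : b₀ + n < r ^ (b₀ + n) := Nat.lt_pow_self (by omega)
      have h2 : 1 * r ^ (b₀ + n) ≤ (r - 1) * r ^ (b₀ + n) := Nat.mul_le_mul_right _ (by omega)
      omega
    have hVp : μ.real {ω | (fun i => X i ω) ∈ V} ≤ 1 - q ^ k := by
      have h1 := hX.pow_le_measureReal_blockSet hq (h _ hb) (k * r ^ (b₀ + n)) k
      have h2 : MeasurableSet {ω | (fun i => X i ω) ∈
          blockSet c (k * r ^ (b₀ + n)) ((r - 1) * r ^ (b₀ + n)) k} :=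
        (measurable_pi_lambda (fun ω i => X i ω) hX.meas) (measurableSet_blockSet _ _ _ _)
      have h3 := probReal_compl_eq_one_sub (μ := μ) h2
      have h4 : {ω | (fun i => X i ω) ∈ V} = {ω | (fun i => X i ω) ∈
          blockSet c (k * r ^ (b₀ + n)) ((r - 1) * r ^ (b₀ + n)) k}ᶜ := rfl
      rw [h4, h3]
      linarith
    rw [e, measureReal_inter_eq_mul hX.indep hX.meas (S := Finset.range (k * r ^ (b₀ + n)))
      (T := Finset.Ico (k * r ^ (b₀ + n)) (k * r ^ (b₀ + n + 1))) ?_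
      (measurableSet_noBlockSet _ _ _ _ _) hVm hUd hVd, pow_succ]
    · exact mul_le_mul ih hVp measureReal_nonneg (pow_nonneg (by linarith) n)
    · rw [Finset.range_eq_Ico]
      exact Finset.Ico_disjoint_Ico_consecutive _ _ _

/-- A point which starts an interval with large block sums starts a window carrying a single
interval whose squared sum is large compared with the length of the window. -/
theorem exists_isPacking_of_notMem_noBlockSet {x : ℕ → ℝ} {c B : ℝ} (hc : 0 ≤ c)
    {r k j₀ J : ℕ} (hr : 2 ≤ r) (hk : 0 < k) (hB : B ≤ c ^ 2 * k) {z : ℕ}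
    (hz : (fun i => x (z + i)) ∉ noBlockSet c r k j₀ J) :
    ∃ n, 0 < n ∧ n ≤ k * r ^ J ∧ ∃ F, IsPacking z (z + n) F ∧
      B * (1 - 1 / r) * n ≤ ∑ I ∈ F, |∑ i ∈ I, x i| ^ 2 := by
  simp only [noBlockSet, Set.mem_ofPred_eq, not_forall, not_not] at hz
  obtain ⟨j, hj, -, hblock⟩ := hz
  have hpos : 0 < r ^ j := pow_pos (by omega) j
  have hlt : r ^ j < r ^ (j + 1) := Nat.pow_lt_pow_right (by omega) (Nat.lt_succ_self j)
  refine ⟨k * r ^ (j + 1), by positivity,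
    Nat.mul_le_mul_left k (Nat.pow_le_pow_right (by omega) hj), _,
    isPacking_singleton (c := z + k * r ^ j) (d := z + k * r ^ (j + 1)) (by omega)
      (by have := Nat.mul_lt_mul_of_pos_left hlt hk; omega) le_rfl, ?_⟩
  rw [Finset.sum_singleton]
  set b := (r - 1) * r ^ j with hb
  have hsum : ∀ m, (∑ i ∈ Finset.Ico (z + k * r ^ j) (z + (k * r ^ j + m * b)), x i) =
      ∑ i ∈ Finset.range m,
        ∑ l ∈ Finset.Ico (k * r ^ j + i * b) (k * r ^ j + (i + 1) * b), x (z + l) := by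
    intro m
    induction m with
    | zero => simp
    | succ m ih =>
      rw [Finset.sum_range_succ, ← ih, Finset.sum_Ico_add (fun i => x i), add_comm _ z,
        add_comm _ z, Finset.sum_Ico_consecutive]
      · omega
      · have : m * b ≤ (m + 1) * b := Nat.mul_le_mul_right b (by omega)
        omega
  have hS : k * (c * √b) ≤
      ∑ i ∈ Finset.Ico (z + k * r ^ j) (z + k * r ^ (j + 1)), x i := by
    rw [← mul_pow_add_eq (by omega), ← hb, hsum k]
    calc (k : ℝ) * (c * √b) = ∑ i ∈ Finset.range k, c * √b := by simp
      _ ≤ _ := Finset.sum_le_sum fun i hi => hblock i (Finset.mem_range.1 hi)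
  have hS2 := pow_le_pow_left₀ (by positivity) hS 2
  rw [sq_abs]
  refine le_trans ?_ hS2
  rw [mul_pow, mul_pow, Real.sq_sqrt (by positivity)]
  have hbr : (1 - 1 / (r : ℝ)) * ((k * r ^ (j + 1) : ℕ) : ℝ) = k * b := by
    have : ((r - 1 : ℕ) : ℝ) = r - 1 := by rw [Nat.cast_sub (by omega)]; simp
    have hr0 : (r : ℝ) ≠ 0 := by positivity
    rw [hb]
    push_cast
    rw [this, pow_succ]
    field_simp
  rw [mul_assoc, hbr]
  calc B * (k * b) ≤ c ^ 2 * k * (k * b) := mul_le_mul_of_nonneg_right hB (by positivity)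
    _ = _ := by ring
end

theorem summable_exp_neg_mul_rpow {a ε : ℝ} (ha : 0 < a) (hε : 0 < ε) :
    Summable fun K : ℕ => Real.exp (-a * ((K : ℝ) + 1) ^ ε) := by
  have h1 : Tendsto (fun K : ℕ => ((K : ℝ) + 1) ^ ε) atTop atTop :=
    (tendsto_rpow_atTop hε).comp (tendsto_atTop_add_const_right _ 1 tendsto_natCast_atTop_atTop)
  have h2 := ((isLittleO_exp_neg_mul_rpow_atTop ha (-2 / ε)).comp_tendsto h1).isBigO
  refine summable_of_isBigO_nat ?_ h2
  have h3 : Summable fun K : ℕ => (((K + 1 : ℕ) : ℝ)) ^ (-2 : ℝ) :=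
    (summable_nat_add_iff 1).2 (Real.summable_nat_rpow.2 (by norm_num))
  refine h3.congr fun K => ?_
  simp only [Function.comp_apply]
  rw [← Real.rpow_mul (by positivity), mul_div_cancel₀ _ hε.ne']
  push_cast
  rfl

theorem eventually_mul_sqrt_two_pow_le {D ε : ℝ} (hε : 0 < ε) :
    ∀ᶠ K : ℕ in atTop, (2 * (K : ℝ) + 3) * (D * √2 ^ K) ≤ ε * 2 ^ K := by
  have hs0 : (0 : ℝ) < √2 := by positivity
  have hs1 : 1 / √2 < 1 := by
    rw [div_lt_one hs0]
    exact Real.lt_sqrt_of_sq_lt (by norm_num)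
  have hs2 : (0 : ℝ) ≤ 1 / √2 := by positivity
  have h1 := (tendsto_self_mul_const_pow_of_lt_one hs2 hs1).const_mul (2 * D)
  have h2 := (tendsto_pow_atTop_nhds_zero_of_lt_one hs2 hs1).const_mul (3 * D)
  have h3 := h1.add h2
  simp only [mul_zero, add_zero] at h3
  filter_upwards [h3.eventually_le_const hε] with K hK
  have e : (2 : ℝ) ^ K = √2 ^ K * √2 ^ K := by
    rw [← mul_pow, Real.mul_self_sqrt (by norm_num)]
  have e2 : (1 / √2) ^ K * √2 ^ K = 1 := by
    rw [← mul_pow, one_div_mul_cancel hs0.ne', one_pow]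
  have h4 := mul_le_mul_of_nonneg_right hK (show 0 ≤ √2 ^ K * √2 ^ K by positivity)
  rw [e]
  refine le_trans (le_of_eq ?_) h4
  calc _ = (2 * D * K + 3 * D) * ((1 / √2) ^ K * √2 ^ K) * √2 ^ K := by rw [e2]; ring
    _ = _ := by ring

theorem two_sub_ten_mul_le {ε : ℝ} (h0 : 0 ≤ ε) (h1 : ε ≤ 1 / 10) :
    2 - 10 * ε ≤ 2 * (1 - ε) ^ 2 * (1 - ε) * (1 - 2 * ε) := by
  have h2 : 1 - 3 * ε ≤ (1 - ε) ^ 2 * (1 - ε) := by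
    nlinarith [mul_nonneg (sq_nonneg ε) (show 0 ≤ 3 - ε by linarith)]
  have h3 := mul_le_mul_of_nonneg_right h2 (show 0 ≤ 1 - 2 * ε by linarith)
  nlinarith

section
variable {Ω : Type*} [MeasurableSpace Ω] {μ : Measure Ω} [IsProbabilityMeasure μ]
  {X : ℕ → Ω → ℝ} {δ : ℝ}

open scoped Classical in
theorem IsStandardIID.mul_measureReal_le_card_le (hX : IsStandardIID μ X δ) {U : Set (ℕ → ℝ)}
    (hU : MeasurableSet U) (n : ℕ) (t : ℝ) :
    t * μ.real {ω | t ≤ ((Finset.range n).filter fun z => (fun i => X (z + i) ω) ∈ U).card} ≤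
      n * μ.real {ω | (fun i => X i ω) ∈ U} := by
  have hmeas : ∀ z : ℕ, MeasurableSet {ω | (fun i => X (z + i) ω) ∈ U} := fun z =>
    (measurable_pi_lambda (fun ω i => X (z + i) ω) fun i => hX.meas _) hU
  have hlaw : ∀ z : ℕ, μ.real {ω | (fun i => X (z + i) ω) ∈ U} =
      μ.real {ω | (fun i => X i ω) ∈ U} := fun z =>
    congrArg ENNReal.toReal
      ((identDistrib_precomp hX.indep hX.ident (add_right_injective z)).measure_mem_eq hU)
  have hi : ∀ z : ℕ, Integrable
      ({ω | (fun i => X (z + i) ω) ∈ U}.indicator fun _ => (1 : ℝ)) μ :=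
    fun z => (integrable_const 1).indicator (hmeas z)
  have hcard : ∀ ω, (((Finset.range n).filter fun z => (fun i => X (z + i) ω) ∈ U).card : ℝ) =
      ∑ z ∈ Finset.range n, {ω | (fun i => X (z + i) ω) ∈ U}.indicator (fun _ => (1 : ℝ)) ω := by
    intro ω
    rw [Finset.card_filter]
    push_cast
    rfl
  simp only [hcard]
  refine (mul_meas_ge_le_integral_of_nonneg (ae_of_all _ fun ω => ?_)
    (integrable_finsetSum _ fun z _ => hi z) t).trans (le_of_eq ?_)
  · exact Finset.sum_nonneg fun z _ => Set.indicator_nonneg (fun _ _ => zero_le_one) _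
  · rw [integral_finsetSum _ fun z _ => hi z]
    simp [integral_indicator_const _ (hmeas _), hlaw]

set_option maxHeartbeats 800000 in
theorem IsStandardIID.eventually_le_squareVariation (hX : IsStandardIID μ X δ) {c' : ℝ}
    (hc' : c' < 2) :
    ∀ᵐ ω ∂μ, ∀ᶠ N : ℕ in atTop,
      c' * N * Real.log (Real.log N) ≤ squareVariation (fun i => X i ω) N := by
  classical
  obtain ⟨ε, hε0, hε1, hεc⟩ : ∃ ε : ℝ, 0 < ε ∧ ε ≤ 1 / 10 ∧ c' ≤ 2 - 10 * ε :=
    ⟨min (1 / 10) ((2 - c') / 10), lt_min (by norm_num) (by linarith), min_le_left _ _, by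
      linarith [min_le_right (1 / 10) ((2 - c') / 10)]⟩
  obtain ⟨c, hc1, b₀, hb₀⟩ := hX.exists_exp_le_measureReal hε0
  set q := Real.exp (-((1 + ε) * c ^ 2 / 2)) with hq
  have hq0 : 0 ≤ q := (Real.exp_pos _).le
  have hq1 : q ≤ 1 := Real.exp_le_one_iff.2 (by
    have : 0 ≤ (1 + ε) * c ^ 2 / 2 := by positivity
    linarith)
  obtain ⟨p, hp0, hp⟩ : ∃ p : ℕ, 0 < p ∧ 1 / ((2 ^ p : ℕ) : ℝ) ≤ ε := by
    obtain ⟨p, hp⟩ := exists_pow_lt_of_lt_one hε0 (show (1 / 2 : ℝ) < 1 by norm_num)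
    refine ⟨p + 1, Nat.succ_pos p, ?_⟩
    push_cast
    rw [← one_div_pow]
    exact (pow_le_pow_of_le_one (by norm_num) (by norm_num) (Nat.le_succ p)).trans hp.le
  set r := 2 ^ p with hr
  have hr2 : 2 ≤ r := by
    calc 2 = 2 ^ 1 := rfl
      _ ≤ _ := Nat.pow_le_pow_right (by norm_num) hp0
  set T : ℕ → ℝ := fun K => Real.log (((K : ℝ) + 1) * Real.log 2) with hT
  set B : ℕ → ℝ := fun K => 2 * (1 - ε) ^ 2 * T K with hB
  set k : ℕ → ℕ := fun K => ⌈B K / c ^ 2⌉₊ with hk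
  set n : ℕ → ℕ := fun K => K / (2 * p) with hn
  set U : ℕ → Set (ℕ → ℝ) := fun K => noBlockSet c r (k K) b₀ (b₀ + n K) with hU
  have hlog2 : 0.69 < Real.log 2 := by linarith [Real.log_two_gt_d9]
  have hlog2' : Real.log 2 < 1 := by linarith [Real.log_two_lt_d9]
  have hTpos : ∀ K, 2 ≤ K → 0 < T K := by
    intro K hK
    have : (2 : ℝ) ≤ K := by exact_mod_cast hK
    exact Real.log_pos (by nlinarith)
  have hTle : ∀ K : ℕ, T K ≤ Real.log ((K : ℝ) + 1) := fun K =>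
    Real.log_le_log (by positivity) (by nlinarith [show (0 : ℝ) ≤ K by positivity])
  have hBpos : ∀ K, 2 ≤ K → 0 < B K := fun K hK => by
    have := hTpos K hK
    have : 0 < 1 - ε := by linarith
    positivity
  have hkle : ∀ K, 2 ≤ K → (k K : ℝ) ≤ B K / c ^ 2 + 1 := fun K hK =>
    (Nat.ceil_lt_add_one (by have := hBpos K hK; positivity)).le
  have hprob : ∀ᶠ K in atTop, μ.real {ω | (fun i => X i ω) ∈ U K} ≤
      Real.exp (-(Real.exp (-c ^ 2) / (4 * p)) * ((K : ℝ) + 1) ^ ε) := by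
    filter_upwards [eventually_ge_atTop (4 * p + 2)] with K hK
    have hK2 : 2 ≤ K := by omega
    refine (hX.measureReal_noBlockSet_le hq0 hq1 hb₀ hr2 (k K) (n K)).trans ?_
    have hqk1 : q ^ k K ≤ 1 := pow_le_one₀ hq0 hq1
    refine (pow_le_pow_left₀ (by linarith) (Real.one_sub_le_exp_neg (q ^ k K)) _).trans ?_
    rw [← Real.exp_nat_mul]
    refine Real.exp_le_exp.2 ?_
    have hqk : Real.exp (-c ^ 2) * Real.exp (-((1 - ε) * Real.log ((K : ℝ) + 1))) ≤ q ^ k K := by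
      rw [hq, ← Real.exp_nat_mul, ← Real.exp_add]
      refine Real.exp_le_exp.2 ?_
      have h1 : (k K : ℝ) * ((1 + ε) * c ^ 2 / 2) ≤ (B K / c ^ 2 + 1) * ((1 + ε) * c ^ 2 / 2) :=
        mul_le_mul_of_nonneg_right (hkle K hK2) (by positivity)
      have h2 : (B K / c ^ 2 + 1) * ((1 + ε) * c ^ 2 / 2) =
          (1 + ε) * (1 - ε) ^ 2 * T K + (1 + ε) * c ^ 2 / 2 := by
        simp only [hB]
        field_simp
      have h3 : (1 + ε) * (1 - ε) ^ 2 * T K ≤ (1 - ε) * Real.log ((K : ℝ) + 1) := by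
        have : (1 + ε) * (1 - ε) ^ 2 ≤ 1 - ε := by
          nlinarith [mul_nonneg (show 0 ≤ 1 - ε by linarith) (sq_nonneg ε)]
        calc _ ≤ (1 - ε) * T K := mul_le_mul_of_nonneg_right this (hTpos K hK2).le
          _ ≤ _ := mul_le_mul_of_nonneg_left (hTle K) (by linarith)
      have h4 : (1 + ε) * c ^ 2 / 2 ≤ c ^ 2 := by nlinarith [sq_nonneg c]
      linarith
    have hnK : ((K : ℝ) + 1) / (4 * p) ≤ n K := by
      have h1 : K < (n K + 1) * (2 * p) := by
        have := Nat.lt_div_mul_add (a := K) (show 0 < 2 * p by omega)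
        simp only [hn]
        rw [add_mul, one_mul]
        exact this
      have h2 : K + 1 ≤ n K * (4 * p) := by
        have : (n K + 1) * (2 * p) = n K * (2 * p) + 2 * p := by ring
        have : n K * (4 * p) = 2 * (n K * (2 * p)) := by ring
        omega
      rw [div_le_iff₀ (by positivity)]
      exact_mod_cast h2
    have hexp : Real.exp (-((1 - ε) * Real.log ((K : ℝ) + 1))) * ((K : ℝ) + 1) =
        ((K : ℝ) + 1) ^ ε := by
      have hK0 : (0 : ℝ) < (K : ℝ) + 1 := by positivity
      rw [Real.rpow_def_of_pos hK0]
      nth_rewrite 2 [← Real.exp_log hK0]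
      rw [← Real.exp_add]
      congr 1
      ring
    rw [← hexp]
    have h5 := mul_le_mul hnK hqk (by positivity) (by positivity)
    refine le_trans (le_of_eq ?_) (le_trans (neg_le_neg h5) (le_of_eq ?_)) <;> ring
  set s : ℕ → Set Ω := fun K => {ω | ε * 2 ^ K ≤
    ((Finset.range (2 ^ (K + 1))).filter fun z => (fun i => X (z + i) ω) ∈ U K).card} with hs
  have hsprob : ∀ᶠ K in atTop, μ.real (s K) ≤
      2 / ε * Real.exp (-(Real.exp (-c ^ 2) / (4 * p)) * ((K : ℝ) + 1) ^ ε) := by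
    filter_upwards [hprob] with K hK
    have h1 := hX.mul_measureReal_le_card_le (U := U K) (measurableSet_noBlockSet _ _ _ _ _)
      (2 ^ (K + 1)) (ε * 2 ^ K)
    have h2 : (2 : ℝ) ^ K * (ε * μ.real (s K)) ≤
        2 ^ K * (2 * μ.real {ω | (fun i => X i ω) ∈ U K}) := by
      have e : ((2 ^ (K + 1) : ℕ) : ℝ) = 2 ^ K * 2 := by push_cast; ring
      rw [e] at h1
      calc _ = ε * 2 ^ K * μ.real (s K) := by ring
        _ ≤ _ := h1
        _ = _ := by ring
    have h3 := le_of_mul_le_mul_left h2 (by positivity)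
    rw [div_mul_eq_mul_div, le_div_iff₀ hε0]
    linarith
  have hsum := (summable_exp_neg_mul_rpow (a := Real.exp (-c ^ 2) / (4 * p)) (by positivity)
    hε0).mul_left (2 / ε)
  filter_upwards [ae_eventually_notMem_of_summable hsum hsprob] with ω hω
  have hlog : Tendsto (fun N : ℕ => Nat.log 2 N) atTop atTop :=
    tendsto_atTop.2 fun m => by
      filter_upwards [eventually_ge_atTop (2 ^ m)] with N hN
      exact Nat.le_log_of_pow_le (by norm_num) hN
  filter_upwards [hlog.eventually hω, hlog.eventually
    (eventually_mul_sqrt_two_pow_le (D := (r : ℝ) ^ b₀) hε0), hlog.eventually_ge_atTop 2,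
    eventually_ge_atTop 3] with N hNs hND hK2 hN3
  set K := Nat.log 2 N with hKdef
  have hKN : 2 ^ K ≤ N := Nat.pow_log_le_self 2 (by omega)
  have hNK : N < 2 ^ (K + 1) := Nat.lt_pow_succ_log_self (by norm_num) N
  have hKN' : (2 : ℝ) ^ K ≤ N := by exact_mod_cast hKN
  have hN0 : (0 : ℝ) < N := by positivity
  set L := k K * r ^ (b₀ + n K) with hL
  have hkpos : 0 < k K := Nat.ceil_pos.2 (by have := hBpos K hK2; positivity)
  have hLle : (L : ℝ) ≤ ε * N := by
    have h1 : (k K : ℝ) ≤ 2 * K + 3 := by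
      have g1 := hkle K hK2
      have g2 : B K / c ^ 2 ≤ B K :=
        div_le_self (hBpos K hK2).le (one_le_pow₀ hc1)
      have g3 : B K ≤ 2 * T K := by
        have : (1 - ε) ^ 2 ≤ 1 := pow_le_one₀ (by linarith) (by linarith)
        have := mul_le_mul_of_nonneg_right this (hTpos K hK2).le
        simp only [hB]
        linarith
      have g4 : T K ≤ K + 1 := (hTle K).trans
        ((Real.log_le_sub_one_of_pos (by positivity)).trans (by linarith))
      linarith
    have h2 : ((r : ℝ)) ^ n K ≤ √2 ^ K := by
      have e1 : ((r : ℝ)) ^ n K = √2 ^ (2 * p * n K) := by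
        rw [mul_assoc, pow_mul, Real.sq_sqrt (by norm_num), pow_mul, hr]
        push_cast
        rfl
      rw [e1]
      exact pow_le_pow_right₀ (Real.one_le_sqrt.2 (by norm_num)) (Nat.mul_div_le K (2 * p))
    rw [hL]
    push_cast
    rw [pow_add]
    calc (k K : ℝ) * ((r : ℝ) ^ b₀ * (r : ℝ) ^ n K)
        ≤ (2 * K + 3) * ((r : ℝ) ^ b₀ * √2 ^ K) := by gcongr
      _ ≤ ε * 2 ^ K := hND
      _ ≤ ε * N := mul_le_mul_of_nonneg_left hKN' hε0.le
  set D := (Finset.range (2 ^ (K + 1))).filter fun z => (fun i => X (z + i) ω) ∈ U K with hD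
  have hDle : (D.card : ℝ) ≤ ε * N := by
    simp only [hs, Set.mem_ofPred_eq, not_le] at hNs
    exact hNs.le.trans (mul_le_mul_of_nonneg_left hKN' hε0.le)
  set G := (Finset.range N).filter fun z => z + L ≤ N ∧ (fun i => X (z + i) ω) ∉ U K with hG
  have hcard : N ≤ G.card + L + D.card := by
    have hsub : Finset.range N ⊆ G ∪ Finset.Ico (N - L) N ∪ D := by
      intro z hz
      simp only [hG, hD, Finset.mem_union, Finset.mem_filter, Finset.mem_range,
        Finset.mem_Ico] at hz ⊢
      by_cases h1 : z + L ≤ N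
      · by_cases h2 : (fun i => X (z + i) ω) ∈ U K
        · exact Or.inr ⟨by omega, h2⟩
        · exact Or.inl (Or.inl ⟨hz, h1, h2⟩)
      · exact Or.inl (Or.inr ⟨by omega, hz⟩)
    have h1 := (Finset.card_le_card hsub).trans (Finset.card_union_le _ _)
    have h2 := Finset.card_union_le G (Finset.Ico (N - L) N)
    rw [Finset.card_range] at h1
    rw [Nat.card_Ico] at h2
    omega
  have hcard' : (1 - 2 * ε) * N ≤ G.card := by
    have : (N : ℝ) ≤ G.card + L + D.card := by exact_mod_cast hcard
    linarith
  have hr1 : 1 - ε ≤ 1 - 1 / (r : ℝ) := by linarith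
  have hA0 : 0 ≤ B K * (1 - 1 / r) := mul_nonneg (hBpos K hK2).le (by linarith)
  have hBc : B K ≤ c ^ 2 * k K := by
    have := Nat.le_ceil (B K / c ^ 2)
    rw [div_le_iff₀ (by positivity)] at this
    linarith
  obtain ⟨F, hF, hFG⟩ := exists_isPacking_card_mul_le (N := N) hA0
    (fun I => |∑ i ∈ I, X i ω| ^ 2) G (by
      intro z hz
      simp only [hG, Finset.mem_filter, Finset.mem_range] at hz
      obtain ⟨m, hm0, hmL, F, hF, hFm⟩ := exists_isPacking_of_notMem_noBlockSet
        (x := fun i => X i ω) (by linarith) hr2 hkpos hBc hz.2.2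
      exact ⟨m, hm0, by omega, F, hF, hFm⟩)
  refine le_trans ?_ (hFG.trans hF.le_squareVariation)
  have hN3' : (3 : ℝ) ≤ N := by exact_mod_cast hN3
  have hlogN1 : 1 ≤ Real.log N := by
    rw [Real.le_log_iff_exp_le hN0]
    linarith [Real.exp_one_lt_d9]
  have hℓ0 : 0 ≤ Real.log (Real.log N) := Real.log_nonneg hlogN1
  have hℓ : Real.log (Real.log N) ≤ T K := by
    refine Real.log_le_log (by linarith) ?_
    have h1 : (N : ℝ) ≤ 2 ^ (K + 1) := by exact_mod_cast hNK.le
    have h2 := Real.log_le_log hN0 h1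
    rw [Real.log_pow] at h2
    push_cast at h2
    exact h2
  have hpoly := two_sub_ten_mul_le hε0.le hε1
  calc c' * N * Real.log (Real.log N)
      ≤ (2 - 10 * ε) * N * Real.log (Real.log N) := by gcongr
    _ ≤ (2 - 10 * ε) * N * T K :=
        mul_le_mul_of_nonneg_left hℓ (mul_nonneg (by linarith) hN0.le)
    _ ≤ (2 * (1 - ε) ^ 2 * (1 - ε) * (1 - 2 * ε)) * N * T K :=
        mul_le_mul_of_nonneg_right (mul_le_mul_of_nonneg_right hpoly hN0.le) (hTpos K hK2).le
    _ = B K * (1 - ε) * ((1 - 2 * ε) * N) := by simp only [hB]; ring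
    _ ≤ B K * (1 - 1 / r) * G.card :=
        mul_le_mul (mul_le_mul_of_nonneg_left hr1 (hBpos K hK2).le) hcard'
          (mul_nonneg (by linarith) hN0.le) hA0
end

theorem squareVariation_const_mul_le (a : ℝ) (x : ℕ → ℝ) (N : ℕ) :
    squareVariation (fun i => a * x i) N ≤ a ^ 2 * squareVariation x N := by
  refine squareVariation_le fun F hF => ?_
  refine le_trans (le_of_eq ?_) (mul_le_mul_of_nonneg_left hF.le_squareVariation (sq_nonneg a))
  rw [Finset.mul_sum]
  refine Finset.sum_congr rfl fun I _ => ?_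
  rw [← Finset.mul_sum, abs_mul, mul_pow, sq_abs a]

theorem squareVariation_const_mul {a : ℝ} (ha : a ≠ 0) (x : ℕ → ℝ) (N : ℕ) :
    squareVariation (fun i => a * x i) N = a ^ 2 * squareVariation x N := by
  refine le_antisymm (squareVariation_const_mul_le a x N) ?_
  have := squareVariation_const_mul_le a⁻¹ (fun i => a * x i) N
  simp only [inv_mul_cancel_left₀ ha] at this
  calc _ ≤ a ^ 2 * (a⁻¹ ^ 2 * squareVariation (fun i => a * x i) N) :=
        mul_le_mul_of_nonneg_left this (sq_nonneg a)
    _ = _ := by field_simp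

theorem squareVariation_zero (N : ℕ) : squareVariation (fun _ => 0) N = 0 := by
  simp [squareVariation]

theorem integrable_abs_rpow_of_le {Ω : Type*} [MeasurableSpace Ω] {μ : Measure Ω}
    [IsFiniteMeasure μ] {Y : Ω → ℝ} (hY : AEMeasurable Y μ) {p q : ℝ} (hp : 0 ≤ p) (hpq : p ≤ q)
    (h : Integrable (fun ω => |Y ω| ^ q) μ) : Integrable (fun ω => |Y ω| ^ p) μ := by
  refine ((integrable_const (1 : ℝ)).add h).mono' ?_ (ae_of_all _ fun ω => ?_)
  · exact (hY.abs.pow_const p).aestronglyMeasurable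
  · rw [Real.norm_of_nonneg (by positivity)]
    simp only [Pi.add_apply]
    rcases le_total |Y ω| 1 with h1 | h1
    · have := Real.rpow_le_one (abs_nonneg _) h1 hp
      have : 0 ≤ |Y ω| ^ q := by positivity
      linarith
    · have := Real.rpow_le_rpow_of_exponent_le h1 hpq
      linarith

theorem IsStandardIID.isEquivalent_squareVariation {Ω : Type*} [MeasurableSpace Ω] {μ : Measure Ω}
    [IsProbabilityMeasure μ] {X : ℕ → Ω → ℝ} {δ : ℝ} (hX : IsStandardIID μ X δ) (hδ : 0 < δ)
    (hδ1 : δ ≤ 1) :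
    ∀ᵐ ω ∂μ, (fun N : ℕ => squareVariation (fun i => X i ω) N) ~[atTop]
      (fun N : ℕ => 2 * (N : ℝ) * Real.log (Real.log (N : ℝ))) := by
  have h1 : ∀ᵐ ω ∂μ, ∀ m : ℕ, ∀ᶠ N : ℕ in atTop, squareVariation (fun i => X i ω) N ≤
      (2 + 1 / ((m : ℝ) + 1)) * N * Real.log (Real.log N) :=
    ae_all_iff.2 fun m => hX.eventually_squareVariation_le hδ hδ1
      (by linarith [show 0 < 1 / ((m : ℝ) + 1) by positivity])
  have h2 : ∀ᵐ ω ∂μ, ∀ m : ℕ, ∀ᶠ N : ℕ in atTop, (2 - 1 / ((m : ℝ) + 1)) * N *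
      Real.log (Real.log N) ≤ squareVariation (fun i => X i ω) N :=
    ae_all_iff.2 fun m => hX.eventually_le_squareVariation
      (by linarith [show 0 < 1 / ((m : ℝ) + 1) by positivity])
  filter_upwards [h1, h2] with ω hω1 hω2
  refine isLittleO_iff.2 fun ε hε => ?_
  obtain ⟨m, hm⟩ := exists_nat_one_div_lt hε
  filter_upwards [hω1 m, hω2 m, tendsto_log_log_natCast.eventually_ge_atTop 0] with N a1 a2 a3
  set ℓ := Real.log (Real.log N)
  have hNℓ : 0 ≤ (N : ℝ) * ℓ := by positivity
  have a4 := mul_le_mul_of_nonneg_right hm.le hNℓ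
  simp only [Pi.sub_apply]
  rw [Real.norm_eq_abs, Real.norm_of_nonneg (by positivity), abs_le]
  constructor <;> nlinarith

theorem theorem1 {Ω : Type*} [MeasurableSpace Ω] (μ : Measure Ω) [IsProbabilityMeasure μ]
    (X : ℕ → Ω → ℝ) (σ δ : ℝ) (hδ : 0 < δ)
    (hindep : iIndepFun X μ)
    (hident : ∀ i, IdentDistrib (X i) (X 0) μ μ)
    (hmean : ∫ ω, X 0 ω ∂μ = 0)
    (hvar : variance (X 0) μ = σ ^ 2)
    (hmom : Integrable (fun ω => |X 0 ω| ^ (2 + δ)) μ) :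
    ∀ᵐ ω ∂μ, (fun N : ℕ => squareVariation (fun i => X i ω) N) ~[atTop]
      (fun N : ℕ => 2 * σ ^ 2 * (N : ℝ) * Real.log (Real.log (N : ℝ))) := by
  rcases eq_or_ne σ 0 with rfl | hσ
  · have hL : MemLp (X 0) 2 μ := by
      refine (memLp_two_iff_integrable_sq (hident 0).aemeasurable_fst.aestronglyMeasurable).2 ?_
      simpa using integrable_abs_rpow_of_le (hident 0).aemeasurable_fst (p := 2) (by norm_num)
        (by linarith) hmom
    have h0 : ∀ i, ∀ᵐ ω ∂μ, X i ω = 0 := fun i => by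
      have h1 : variance (X i) μ = 0 := by rw [(hident i).variance_eq, hvar]; simp
      have h2 := ae_eq_integral_of_variance_eq_zero ((hident i).memLp_iff.2 hL) h1
      rw [(hident i).integral_eq, hmean] at h2
      exact h2
    filter_upwards [ae_all_iff.2 h0] with ω hω
    simp only [hω, squareVariation_zero]
    simpa using IsEquivalent.refl
  have hae : ∀ i, AEMeasurable (X i) μ := fun i => (hident i).aemeasurable_fst
  set Y : ℕ → Ω → ℝ := fun i ω => σ⁻¹ * (hae i).mk (X i) ω with hY
  have hYm : ∀ i, Measurable (Y i) := fun i => (hae i).measurable_mk.const_mul _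
  have hYX : ∀ i, (fun ω => σ⁻¹ * X i ω) =ᵐ[μ] Y i := fun i => by
    filter_upwards [(hae i).ae_eq_mk] with ω hω
    simp only [hY, ← hω]
  have hL : MemLp (X 0) 2 μ := by
    refine (memLp_two_iff_integrable_sq (hae 0).aestronglyMeasurable).2 ?_
    simpa using integrable_abs_rpow_of_le (hae 0) (p := 2) (by norm_num) (by linarith) hmom
  have hstd : IsStandardIID μ Y (min δ 1) := by
    have hmom' : Integrable (fun ω => |X 0 ω| ^ (2 + min δ 1)) μ :=
      integrable_abs_rpow_of_le (hae 0) (by positivity) (by linarith [min_le_left δ 1]) hmom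
    refine ⟨?_, hYm, fun i => ?_, ?_, ?_, ?_, ?_⟩
    · exact (iIndepFun_congr hYX).1
        (hindep.comp (fun _ x => σ⁻¹ * x) fun _ => measurable_const_mul _)
    · have h1 : ∀ i, IdentDistrib (fun ω => σ⁻¹ * X i ω) (Y i) μ μ := fun i =>
        IdentDistrib.of_ae_eq ((hae i).const_mul _) (hYX i)
      exact ((h1 i).symm.trans ((hident i).const_mul σ⁻¹)).trans (h1 0)
    · exact (memLp_congr_ae (hYX 0)).1 (hL.const_mul σ⁻¹)
    · rw [← integral_congr_ae (hYX 0), integral_const_mul, hmean, mul_zero]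
    · have h1 : ∫ ω, X 0 ω ^ 2 ∂μ = σ ^ 2 := by
        rw [← hvar, variance_of_integral_eq_zero (hae 0) hmean]
      have h2 : (fun ω => (σ⁻¹ * X 0 ω) ^ 2) =ᵐ[μ] fun ω => Y 0 ω ^ 2 := by
        filter_upwards [hYX 0] with ω hω
        rw [hω]
      rw [← integral_congr_ae h2]
      simp only [mul_pow]
      rw [integral_const_mul, h1]
      field_simp
    · have h2 : (fun ω => |σ⁻¹| ^ (2 + min δ 1) * |X 0 ω| ^ (2 + min δ 1)) =ᵐ[μ]
          fun ω => |Y 0 ω| ^ (2 + min δ 1) := by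
        filter_upwards [hYX 0] with ω hω
        rw [← hω, abs_mul, Real.mul_rpow (abs_nonneg _) (abs_nonneg _)]
      exact (hmom'.const_mul _).congr h2
  filter_upwards [hstd.isEquivalent_squareVariation (lt_min hδ one_pos) (min_le_right _ _),
    ae_all_iff.2 hYX] with ω hω hω2
  have e : (fun i => X i ω) = fun i => σ * Y i ω := by
    funext i
    rw [← hω2 i, mul_inv_cancel_left₀ hσ]
  rw [e]
  simp only [squareVariation_const_mul hσ]
  refine ((IsEquivalent.refl (u := fun _ : ℕ => σ ^ 2)).mul hω).congr_right ?_
  exact Eventually.of_forall fun N => by simp only [Pi.mul_apply]; ring
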